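/- Draw the complete graph $K_4$ in the plane as a wheel: a hub $C$ and rim vertices $P,Q,R$ in this counterclockwise order around $C$. Let $T$ be the Y-shaped tree formed by the three spokes $CP, CQ, CR$, and let $T'$ be the dual Y-shaped tree, whose three edges start in the outer region, cross the rim edges $PQ, QR, RP$, and end in the triangles $CPQ, CQR, CRP$, respectively. For integers $p,q,r,a,b,c$ let $K\left(\begin{smallmatrix} p&q&r\\ a&b&c\end{smallmatrix}\right)$ be the unoriented link whose diagram on the sphere is obtained as follows. Along each of the six tree edges run two parallel strands, one on each side of the edge. The ends of strands of neighbouring tree edges are joined, inside the region of the plane where they lie, by arcs without crossings (three around $C$, three in the outer region, two in each of the three triangles), so that without twists one obtains the boundary curve of a neighbourhood of $T$. Finally, $|p|,|q|,|r|$ half twists (crossings) are inserted in the pairs of strands along $CP,CQ,CR$, and $|a|,|b|,|c|$ half twists in the pairs of strands along the edges of $T'$ crossing $PQ,QR,RP$. The sign of a label fixes the handedness of its half twists: if the two strands are given antiparallel directions, the crossings are positive for a positive label and negative for a negative label. Two links are regarded as equal if they are isotopic, that is, if their diagrams are related by planar isotopy and finitely many Reidemeister moves. **Theorem 4.10.**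 Suppose that $p,q,r,a,b,c$ are even integers and $p\neq a$. If $$K\left(\begin{smallmatrix} p&q&r\\ a&b&c\end{smallmatrix}\right)=K\left(\begin{smallmatrix} a&q&r\\ p&b&c\end{smallmatrix}\right),$$ then either $q=c=0$, or $q=c$ and $b=r$. -/

import Mathlib

/-!
Knots are given by diagrams on the sphere, and two diagrams present the same (unoriented) knot or
link when they are related by planar isotopy and Reidemeister moves.

A diagram is recorded as a planar diagram code.  The diagram is cut at finitely many points; each
cut point has a label.  The pieces are plain arcs and crossings.
-/

/-- A piece of a link diagram whose ends carry labels.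
* `strand a b` is an arc without crossings with ends `a` and `b`.
* `crossing a b c d` is one crossing; its four ends are `a`, `b`, `c`, `d` in counterclockwise
  order, the strand from `a` to `c` passes under the strand from `b` to `d`. -/
inductive Item (L : Type) : Type
  | strand (a b : L) : Item L
  | crossing (a b c d : L) : Item L

namespace Item

variable {L : Type}

/-- The ends of a piece, in counterclockwise order. -/
def ends : Item L → List L
  | strand a b => [a, b]
  | crossing a b c d => [a, b, c, d]

/-- Change the labels of the ends. -/
def map (f : L → L) : Item L → Item L
  | strand a b => strand (f a) (f b)
  | crossing a b c d => crossing (f a) (f b) (f c) (f d)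

end Item

/-- A diagram code: a finite list of pieces, to be glued at ends that carry the same label.
The order of the list has no meaning (see `Move.perm`). -/
abbrev DiagramCode (L : Type) : Type := List (Item L)

namespace DiagramCode

variable {L : Type}

/-- All ends of all pieces. -/
def allEnds (D : DiagramCode L) : List L := D.flatMap Item.ends

/-- Every label that occurs is carried by exactly two ends, which are glued to each other. -/
def Glued [DecidableEq L] (D : DiagramCode L) : Prop :=
  ∀ x ∈ D.allEnds, D.allEnds.count x = 2

/-- The half-edges of the 4-valent graph (with extra vertices of valence 2 at the strands) that
underlies the diagram: an index of a piece and a position among the ends of that piece. -/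
abbrev HalfEdge (D : DiagramCode L) : Type :=
  (i : Fin D.length) × Fin (D.get i).ends.length

/-- The label of a half-edge. -/
def label (D : DiagramCode L) (h : D.HalfEdge) : L := (D.get h.1).ends.get h.2

/-- The next half-edge at the same piece in counterclockwise order. -/
def ccw (D : DiagramCode L) (h : D.HalfEdge) : D.HalfEdge := ⟨h.1, finRotate _ h.2⟩

/-- Corners of the complementary regions: the half-edge `h` also stands for the corner between `h`
and the next half-edge `ccw h`.  Following the edge that starts with `ccw h` to its other half `k`,
with the region on the right, one gets to the corner between `k` and `ccw k`
of the same region. -/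
def FaceStep (D : DiagramCode L) (h k : D.HalfEdge) : Prop :=
  k ≠ D.ccw h ∧ D.label k = D.label (D.ccw h)

/-- The number of complementary regions, each connected part being put on its own sphere. -/
noncomputable def faceCount (D : DiagramCode L) : ℕ := Nat.card (Quot D.FaceStep)

/-- Two half-edges at the same piece or on the same edge. -/
def Adjacent (D : DiagramCode L) (h k : D.HalfEdge) : Prop :=
  h.1 = k.1 ∨ D.label h = D.label k

/-- The number of connected parts of the underlying graph. -/
noncomputable def partCount (D : DiagramCode L) : ℕ := Nat.card (Quot D.Adjacent)

/-- Every connected part of the diagram lies on the sphere, by Euler's formula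
`V - E + F = 2 * (number of connected parts)`. -/
def Planar [DecidableEq L] (D : DiagramCode L) : Prop :=
  D.length + D.faceCount = D.allEnds.toFinset.card + 2 * D.partCount

/-- The codes of link diagrams. -/
def IsLinkDiagram [DecidableEq L] (D : DiagramCode L) : Prop := D.Glued ∧ D.Planar

open Item in
/-- Changes of the code that do not change the diagram (`perm` to `absorb`), and
the Reidemeister moves (`r1` to `r3'`).  In every move `D` is the part of the diagram
that is left alone. -/
inductive Move [DecidableEq L] : DiagramCode L → DiagramCode L → Prop
  /-- The order of the pieces is irrelevant. -/
  | perm (D D' : DiagramCode L) (h : D.Perm D') : Move D D'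
  /-- The direction of a plain arc is irrelevant. -/
  | flip (a b : L) (D : DiagramCode L) : Move (strand a b :: D) (strand b a :: D)
  /-- The counterclockwise list of ends may start at either end of the lower strand. -/
  | rotate (a b c d : L) (D : DiagramCode L) :
      Move (crossing a b c d :: D) (crossing c d a b :: D)
  /-- A plain arc can be absorbed into what it is glued to. -/
  | absorb (a b : L) (hab : a ≠ b) (D : DiagramCode L) :
      Move (strand a b :: D) (List.map (Item.map fun x => if x = b then a else x) D)
  /-- First Reidemeister move. -/
  | r1 (a c d : L) (D : DiagramCode L) :
      Move (crossing a a c d :: D) (strand c d :: D)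
  /-- First Reidemeister move, curl of the other sign. -/
  | r1' (a b d : L) (D : DiagramCode L) :
      Move (crossing a b b d :: D) (strand a d :: D)
  /-- Second Reidemeister move: on the left hand side the arc from `x₁` to `y₁` passes under the
  arc from `x₂` to `y₂` twice, and the two crossings span a bigon with edges `u₁`, `u₂`. -/
  | r2 (x₁ x₂ y₁ y₂ u₁ u₂ : L) (D : DiagramCode L) :
      Move (crossing x₁ x₂ u₂ u₁ :: crossing u₂ y₂ y₁ u₁ :: D)
        (strand x₁ y₁ :: strand x₂ y₂ :: D)
  /-- Third Reidemeister move: the arc from `x₁` to `y₃` is below the arc from `x₂` to `y₂`, which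
  is below the arc from `x₃` to `y₁`.  The triangle has edges `u₁`, `u₂`, `v`, resp.
  `s₂`, `s₃`, `t`. -/
  | r3 (x₁ x₂ x₃ y₁ y₂ y₃ u₁ u₂ v s₂ s₃ t : L) (D : DiagramCode L) :
      Move (crossing x₁ x₂ u₂ u₁ :: crossing u₂ x₃ y₃ v :: crossing u₁ v y₂ y₁ :: D)
        (crossing x₂ x₃ s₃ s₂ :: crossing x₁ s₂ t y₁ :: crossing t s₃ y₃ y₂ :: D)
  /-- Third Reidemeister move, with all crossings changed. -/
  | r3' (x₁ x₂ x₃ y₁ y₂ y₃ u₁ u₂ v s₂ s₃ t : L) (D : DiagramCode L) :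
      Move (crossing x₂ u₂ u₁ x₁ :: crossing x₃ y₃ v u₂ :: crossing v y₂ y₁ u₁ :: D)
        (crossing x₃ s₃ s₂ x₂ :: crossing s₂ t y₁ x₁ :: crossing s₃ y₃ y₂ t :: D)

/-- A single move between two link diagrams.  (Since the code on both sides has to be a link
diagram, the labels of inner edges are new, and a second Reidemeister move can only
create crossings between arcs that can be brought next to each other.) -/
def Step [DecidableEq L] (D D' : DiagramCode L) : Prop :=
  D.IsLinkDiagram ∧ D'.IsLinkDiagram ∧ Move D D'

/-- The diagrams present the same unoriented knot or link: they are related by finitely many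
moves, in both directions.  (To be used with an infinite set of labels.) -/
def SameKnot [DecidableEq L] (D D' : DiagramCode L) : Prop := Relation.EqvGen Step D D'

end DiagramCode

/-!
The diagram of girth 3.  Draw the complete graph with 4 vertices in the plane: a hub `C` and three
rim vertices `P`, `Q`, `R`, counterclockwise around `C`.  The Y-shaped tree `T` consists of the
spokes `p = CP`, `q = CQ`, `r = CR`.  The rim edges are `PQ`, `QR`, `RP`, and the Y-shaped tree `T'`
consists of the three edges `a`, `b`, `c` of the dual graph that cross these; they join the outer
region to the triangles `CPQ`, `CQR`, `CRP`.  Spokes are directed from `C` outwards and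
`a`, `b`, `c` from the outer region inwards.  Along each of the six edges there are two parallel
strands, on the left and on the right of the edge, twisted as often as the label of the edge says.
-/

/-- The edges of the two Y-shaped trees. -/
inductive TreeEdge : Type
  | p | q | r | a | b | c
  deriving DecidableEq

/-- A cut point: on the left or on the right of the edge, after `level` half twists. -/
structure CutPoint : Type where
  edge : TreeEdge
  left : Bool
  level : ℕ
  deriving DecidableEq

namespace Girth3

/-- The cut point on the left of `e`, after `j` half twists. -/
def lt (e : TreeEdge) (j : ℕ) : CutPoint := ⟨e, true, j⟩

/-- The cut point on the right of `e`, after `j` half twists. -/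
def rt (e : TreeEdge) (j : ℕ) : CutPoint := ⟨e, false, j⟩

/-- A row of `|n|` half twists along the edge `e`.  The sign of `n` says which strand
is on top: for antiparallel strands the crossings are positive if `n > 0` and negative
if `n < 0`. -/
def twist (e : TreeEdge) (n : ℤ) : DiagramCode CutPoint :=
  (List.range n.natAbs).map fun j =>
    if 0 < n then Item.crossing (lt e j) (rt e j) (rt e (j + 1)) (lt e (j + 1))
    else Item.crossing (rt e j) (rt e (j + 1)) (lt e (j + 1)) (lt e j)

open Item TreeEdge in
/-- The diagram with rows of `p, q, r` half twists on the edges of `T` and `a, b, c` half twists on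
the edges of `T'`. -/
def K (np nq nr na nb nc : ℤ) : DiagramCode CutPoint :=
  twist p np ++ twist q nq ++ twist r nr ++ twist a na ++ twist b nb ++ twist c nc ++
  [ -- around the hub `C`
    strand (lt p 0) (rt q 0), strand (lt q 0) (rt r 0), strand (lt r 0) (rt p 0),
    -- around the outer region
    strand (lt a 0) (rt c 0), strand (lt b 0) (rt a 0), strand (lt c 0) (rt b 0),
    -- in the triangle `CPQ`
    strand (lt p np.natAbs) (lt a na.natAbs), strand (rt q nq.natAbs) (rt a na.natAbs),
    -- in the triangle `CQR`
    strand (lt q nq.natAbs) (lt b nb.natAbs), strand (rt r nr.natAbs) (rt b nb.natAbs),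
    -- in the triangle `CRP`
    strand (lt r nr.natAbs) (lt c nc.natAbs), strand (rt p np.natAbs) (rt c nc.natAbs) ]

end Girth3

/-!
The colourings of a link diagram by a quandle with an involution that reverses arcs are counted over
all orientations at once, so that their number is an invariant of unoriented links.  The colours
used here consist of a direction and an element of `R = S[t] / (t² - (2 + ζ) t + 1)`, and arcs act
as in the Alexander quandle.  For even labels the relations force the two strands along every tree
edge to be antiparallel, and a full twist then adds a multiple of the difference of the two values
to both of them.  So, apart from a choice of one direction and one value, a colouring of `K` is a
solution over `R` of a linear system given by an integer `2 × 2` matrix.  Its determinant is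
`1 + a₂ ζ + a₄ ζ²`, the Conway polynomial of `K` at `z² = ζ = t - 2 + t⁻¹`.

For `S = ZMod m` with `m` divisible by the determinant, the number of solutions is the square of the
determinant.  As the determinant is `1` modulo `ζ`, this determines it for `ζ > 2`, hence also
`a₂` and `a₄`.  When `p` and `a` are exchanged, the invariance of `a₂` says that
`(p - a) (q - c) = 0`, and with `q = c` that of `a₄` says that `(p - a) q² (r - b) = 0`.
-/

open scoped Quandles

/-! ### Colourings by symmetric quandles -/

/-- Symmetric quandles in the sense of Kamada, the structures that colour unoriented links:
`rev x` stands for the colour of an arc coloured by `x` when its direction is reversed. -/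
class SymmetricQuandle (X : Type*) extends Quandle X where
  /-- The good involution. -/
  rev : X → X
  rev_rev : ∀ x, rev (rev x) = x
  act_rev : ∀ x y : X, x ◃ rev y = rev (x ◃ y)
  rev_act : ∀ x y : X, rev x ◃ y = x ◃⁻¹ y

namespace SymmetricQuandle

attribute [simp] rev_rev

variable {X : Type*} [SymmetricQuandle X]

theorem rev_injective : Function.Injective (rev : X → X) :=
  Function.LeftInverse.injective rev_rev

@[simp] theorem rev_inj {x y : X} : rev x = rev y ↔ x = y := rev_injective.eq_iff

theorem rev_eq_comm {x y : X} : rev x = y ↔ rev y = x := by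
  rw [← rev_inj, rev_rev, eq_comm]

@[simp] theorem act_rev_act (x y : X) : x ◃ (rev x ◃ y) = y := by
  rw [rev_act, Rack.act_invAct_eq]

@[simp] theorem rev_act_act (x y : X) : rev x ◃ (x ◃ y) = y := by
  rw [rev_act, Rack.invAct_act_eq]

@[simp] theorem rev_act_self (x : X) : rev x ◃ x = x := by
  simpa only [Quandle.fix] using rev_act_act x x

end SymmetricQuandle

open SymmetricQuandle

namespace Item

variable {L M X : Type}

/-- The functorial version of `Item.map`, which may change the type of labels. -/
def mapEnds (f : L → M) : Item L → Item M
  | strand a b => strand (f a) (f b)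
  | crossing a b c d => crossing (f a) (f b) (f c) (f d)

theorem ends_mapEnds (f : L → M) (i : Item L) : (i.mapEnds f).ends = i.ends.map f := by
  cases i <;> rfl

theorem map_eq_mapEnds (f : L → L) : map f = mapEnds f := by
  ext i; cases i <;> rfl

/-- The quandle relations at a piece whose ends carry colours, the colour at an end being the one
for the direction into the piece. -/
def Colored [SymmetricQuandle X] : Item (L × X) → Prop
  | strand a b => b.2 = rev a.2
  | crossing a b c d => d.2 = rev b.2 ∧ c.2 = rev (b.2 ◃ a.2)

end Item

namespace DiagramCode

open Item

variable {L M X : Type}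

@[simp] theorem allEnds_nil : allEnds ([] : DiagramCode L) = [] := rfl

@[simp] theorem allEnds_cons (i : Item L) (D : DiagramCode L) :
    allEnds (i :: D) = i.ends ++ allEnds D := rfl

@[simp] theorem allEnds_append (D D' : DiagramCode L) :
    allEnds (D ++ D') = allEnds D ++ allEnds D' := List.flatMap_append

theorem allEnds_mapEnds (f : L → M) (D : DiagramCode L) :
    allEnds (D.map (mapEnds f)) = D.allEnds.map f := by
  simp only [allEnds, List.flatMap_map, List.map_flatMap, ends_mapEnds]

theorem perm_allEnds {D D' : DiagramCode L} (h : D.Perm D') : D.allEnds.Perm D'.allEnds :=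
  h.flatMap_right _

variable [SymmetricQuandle X]

/-- `E` arises from the code `D` by attaching colours to the ends of the pieces, subject to the
quandle relation at every piece. -/
def Colors (E : DiagramCode (L × X)) (D : DiagramCode L) : Prop :=
  E.map (mapEnds Prod.fst) = D ∧ ∀ i ∈ E, i.Colored

/-- The condition on two coloured ends that are glued if they have the same label: what enters
the one piece leaves the other. -/
def Matches (e e' : L × X) : Prop := e.1 = e'.1 → e'.2 = rev e.2

variable (X) in
/-- The colourings of a code by a symmetric quandle.  No orientation is chosen. -/
def Coloring (D : DiagramCode L) : Type :=
  {E : DiagramCode (L × X) // E.Colors D ∧ E.allEnds.Pairwise Matches}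

theorem Matches.symm {e e' : L × X} (h : Matches e e') : Matches e' e := fun hl => by
  rw [h hl.symm, rev_rev]

theorem Colors.map_fst_allEnds {E : DiagramCode (L × X)} {D : DiagramCode L} (h : E.Colors D) :
    E.allEnds.map Prod.fst = D.allEnds := by
  rw [← h.1, allEnds_mapEnds]

@[simp] theorem colors_nil_right {E : DiagramCode (L × X)} : E.Colors [] ↔ E = [] := by
  constructor
  · exact fun h => List.map_eq_nil_iff.1 h.1
  · rintro rfl
    exact ⟨rfl, by simp⟩

theorem colors_cons_right {E : DiagramCode (L × X)} {i : Item L} {D : DiagramCode L} :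
    E.Colors (i :: D) ↔
      ∃ (j : _) (F : DiagramCode (L × X)),
        E = j :: F ∧ (j.mapEnds Prod.fst = i ∧ j.Colored) ∧ F.Colors D := by
  simp only [Colors, List.map_eq_cons_iff]
  constructor
  · rintro ⟨⟨j, F, rfl, hj, hF⟩, hc⟩
    rw [List.forall_mem_cons] at hc
    exact ⟨j, F, rfl, ⟨hj, hc.1⟩, hF, hc.2⟩
  · rintro ⟨j, F, rfl, ⟨hj, hj'⟩, hF, hF'⟩
    exact ⟨⟨j, F, rfl, hj, hF⟩, List.forall_mem_cons.2 ⟨hj', hF'⟩⟩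

theorem colors_strand_cons {E : DiagramCode (L × X)} {a b : L} {D : DiagramCode L} :
    E.Colors (strand a b :: D) ↔
      ∃ (x : X) (F : DiagramCode (L × X)), E = strand (a, x) (b, rev x) :: F ∧ F.Colors D := by
  rw [colors_cons_right]
  constructor
  · rintro ⟨_ | _, F, rfl, ⟨hj, hj'⟩, hF⟩ <;> cases hj
    rename_i u v
    exact ⟨u.2, F, by rw [← show v.2 = rev u.2 from hj'], hF⟩
  · rintro ⟨x, F, rfl, hF⟩
    exact ⟨_, F, rfl, ⟨rfl, rfl⟩, hF⟩

theorem colors_crossing_cons {E : DiagramCode (L × X)} {a b c d : L} {D : DiagramCode L} :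
    E.Colors (crossing a b c d :: D) ↔
      ∃ (x y : X) (F : DiagramCode (L × X)),
        E = crossing (a, x) (b, y) (c, rev (y ◃ x)) (d, rev y) :: F ∧ F.Colors D := by
  rw [colors_cons_right]
  constructor
  · rintro ⟨_ | _, F, rfl, ⟨hj, hj'⟩, hF⟩ <;> cases hj
    rename_i s t u v
    obtain ⟨hv, hu⟩ : v.2 = rev t.2 ∧ u.2 = rev (t.2 ◃ s.2) := hj'
    exact ⟨s.2, t.2, F, by rw [← hu, ← hv], hF⟩
  · rintro ⟨x, y, F, rfl, hF⟩
    exact ⟨_, F, rfl, ⟨rfl, rfl, rfl⟩, hF⟩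

theorem colors_append_right {E : DiagramCode (L × X)} {A D : DiagramCode L} :
    E.Colors (A ++ D) ↔ ∃ F G : DiagramCode (L × X), E = F ++ G ∧ F.Colors A ∧ G.Colors D := by
  simp only [Colors, List.map_eq_append_iff]
  constructor
  · rintro ⟨⟨F, G, rfl, hF, hG⟩, hc⟩
    rw [List.forall_mem_append] at hc
    exact ⟨F, G, rfl, ⟨hF, hc.1⟩, hG, hc.2⟩
  · rintro ⟨F, G, rfl, ⟨hF, hF'⟩, hG, hG'⟩
    exact ⟨⟨F, G, rfl, hF, hG⟩, List.forall_mem_append.2 ⟨hF', hG'⟩⟩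

/-- The same end, with the colour for the opposite direction. -/
def opposite : L × X → L × X := Prod.map id rev

theorem opposite_mk (x : L) (u : X) : opposite (x, u) = (x, rev u) := rfl

theorem matches_opposite (e : L × X) : Matches e (opposite e) := fun _ => rfl

theorem matches_of_getElem? {l : List (L × X)} (hl : l.Pairwise Matches) {i j : ℕ} {x : L}
    {u v : X} (hij : i < j) (hi : l[i]? = some (x, u)) (hj : l[j]? = some (x, v)) :
    v = rev u := by
  obtain ⟨hi', hi⟩ := List.getElem?_eq_some_iff.1 hi
  obtain ⟨hj', hj⟩ := List.getElem?_eq_some_iff.1 hj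
  have h := List.pairwise_iff_getElem.1 hl i j hi' hj' hij
  rw [hi, hj] at h
  exact h rfl

theorem pairwise_matches_cons_cons_opposite {e : L × X} {l : List (L × X)}
    (he : e.1 ∉ l.map Prod.fst) :
    (e :: opposite e :: l).Pairwise Matches ↔ l.Pairwise Matches := by
  have h : ∀ f ∈ l, e.1 ≠ f.1 := fun f hf hef => he (hef ▸ List.mem_map_of_mem hf)
  simp only [List.pairwise_cons, List.mem_cons, forall_eq_or_imp, matches_opposite, true_and]
  exact ⟨fun hl => hl.2.2, fun hl =>
    ⟨fun f hf hef => (h f hf hef).elim, fun f hf hef => (h f hf hef).elim, hl⟩⟩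

theorem pairwise_matches_append_opposite [DecidableEq L] {l m : List (L × X)}
    (h : ∀ x ∈ l.map Prod.fst, ((l ++ l.map opposite ++ m).map Prod.fst).count x = 2) :
    (l ++ l.map opposite ++ m).Pairwise Matches ↔ m.Pairwise Matches := by
  induction l with
  | nil => rfl
  | cons e l ih =>
    have hperm : (e :: l ++ (e :: l).map opposite ++ m).Perm
        (e :: opposite e :: (l ++ l.map opposite ++ m)) := by
      simp only [List.map_cons, List.cons_append, List.append_assoc]
      exact List.perm_middle.cons e
    simp only [((hperm.map Prod.fst).count_eq _)] at h
    have hcount : (((l ++ l.map opposite ++ m)).map Prod.fst).count e.1 = 0 := by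
      have := h e.1 (by simp)
      simpa [opposite] using this
    have hmem := List.count_eq_zero.1 hcount
    rw [hperm.pairwise_iff Matches.symm, pairwise_matches_cons_cons_opposite hmem]
    refine ih fun x hx => ?_
    have hne : e.1 ≠ x := by
      rintro rfl
      refine hmem ?_
      rw [List.map_append, List.map_append]
      simp only [List.mem_append, hx, true_or]
    have := h x (by rw [List.map_cons]; exact List.mem_cons_of_mem _ hx)
    simpa [opposite, hne] using this

/-- The colourings of a part `A` of a diagram are the values of `lift`.  Their ends come in pairs
that are glued inside `A`, except for the ends in the list `outer u`. -/
structure ParametrizesColorings {P : Type} (A : DiagramCode L) (lift : P → DiagramCode (L × X))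
    (outer : P → List (L × X)) : Prop where
  injective : Function.Injective lift
  colors : ∀ u, (lift u).Colors A
  perm_allEnds : ∀ u, ∃ inner : List (L × X),
    (lift u).allEnds.Perm (inner ++ inner.map opposite ++ outer u)
  exists_lift_eq : ∀ E : DiagramCode (L × X), E.Colors A → E.allEnds.Pairwise Matches →
    ∃ u, lift u = E

namespace ParametrizesColorings

variable [DecidableEq L] {P : Type} {A B D : DiagramCode L} {lift lift' : P → DiagramCode (L × X)}
  {outer : P → List (L × X)}

theorem pairwise_allEnds_iff (hA : ParametrizesColorings A lift outer) (h : (A ++ D).Glued)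
    (u : P) {F : DiagramCode (L × X)} (hF : F.Colors D) :
    (lift u ++ F).allEnds.Pairwise Matches ↔ (outer u ++ F.allEnds).Pairwise Matches := by
  obtain ⟨inner, hinner⟩ := hA.perm_allEnds u
  have hperm : (lift u ++ F).allEnds.Perm
      (inner ++ inner.map opposite ++ (outer u ++ F.allEnds)) := by
    rw [allEnds_append, ← List.append_assoc]
    exact hinner.append_right _
  rw [hperm.pairwise_iff Matches.symm]
  refine pairwise_matches_append_opposite fun x hx => ?_
  have hfst : (lift u ++ F).allEnds.map Prod.fst = (A ++ D).allEnds := by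
    rw [allEnds_append, List.map_append, (hA.colors u).map_fst_allEnds, hF.map_fst_allEnds,
      allEnds_append]
  rw [← (hperm.map _).count_eq, hfst]
  refine h x ?_
  rw [← hfst, (hperm.map _).mem_iff, List.map_append, List.map_append]
  simp only [List.mem_append, hx, true_or]

theorem card_coloring (hA : ParametrizesColorings A lift outer) (h : (A ++ D).Glued) :
    Nat.card (Coloring X (A ++ D)) = Nat.card {uF : P × DiagramCode (L × X) //
      uF.2.Colors D ∧ (outer uF.1 ++ uF.2.allEnds).Pairwise Matches} := by
  symm
  refine Nat.card_congr (Equiv.ofBijective (fun uF => ⟨lift uF.1.1 ++ uF.1.2,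
    colors_append_right.2 ⟨_, _, rfl, hA.colors _, uF.2.1⟩,
    (hA.pairwise_allEnds_iff h _ uF.2.1).2 uF.2.2⟩) ⟨?_, ?_⟩)
  · intro ⟨⟨u, F⟩, hF, _⟩ ⟨⟨v, G⟩, hG, _⟩ huv
    have hlen : F.length = G.length := by
      rw [← F.length_map, hF.1, ← hG.1, List.length_map]
    obtain ⟨h₁, rfl⟩ := List.append_inj' (congrArg Subtype.val huv) hlen
    obtain rfl := hA.injective h₁
    rfl
  · rintro ⟨E, hE, hE'⟩
    obtain ⟨F, G, rfl, hF, hG⟩ := colors_append_right.1 hE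
    obtain ⟨u, rfl⟩ := hA.exists_lift_eq F hF
      (hE'.sublist (by rw [allEnds_append]; exact List.sublist_append_left _ _))
    exact ⟨⟨(u, G), hG, (hA.pairwise_allEnds_iff h u hG).1 hE'⟩, rfl⟩

theorem card_coloring_eq (hA : ParametrizesColorings A lift outer)
    (hB : ParametrizesColorings B lift' outer) (h : (A ++ D).Glued) (h' : (B ++ D).Glued) :
    Nat.card (Coloring X (A ++ D)) = Nat.card (Coloring X (B ++ D)) := by
  rw [hA.card_coloring h, hB.card_coloring h']

end ParametrizesColorings

end DiagramCode

/-! ### Invariance under Reidemeister moves -/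

theorem exists_equiv_lifts_of_perm {α β : Type*} (π : α → β) {l l' : List β} (h : l.Perm l') :
    ∃ φ : List α ≃ List α, (∀ m, (φ m).Perm m) ∧ ∀ m, (φ m).map π = l' ↔ m.map π = l := by
  induction h with
  | nil => exact ⟨.refl _, fun _ => .rfl, fun _ => .rfl⟩
  | cons x _ ih =>
    obtain ⟨φ, hperm, hφ⟩ := ih
    refine ⟨⟨fun | [] => [] | c :: m => c :: φ m, fun | [] => [] | c :: m => c :: φ.symm m,
      ?_, ?_⟩, ?_, ?_⟩ <;> rintro (_ | ⟨c, m⟩) <;> simp [hperm, hφ]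
  | swap x y _ =>
    refine ⟨⟨fun | c :: d :: m => d :: c :: m | m => m, fun | c :: d :: m => d :: c :: m | m => m,
      ?_, ?_⟩, ?_, ?_⟩ <;> rintro (_ | ⟨c, _ | ⟨d, m⟩⟩) <;> simp [List.Perm.swap, and_left_comm]
  | trans _ _ ih₁ ih₂ =>
    obtain ⟨φ₁, hperm₁, hφ₁⟩ := ih₁
    obtain ⟨φ₂, hperm₂, hφ₂⟩ := ih₂
    exact ⟨φ₁.trans φ₂, fun m => (hperm₂ _).trans (hperm₁ m), fun m => (hφ₂ _).trans (hφ₁ m)⟩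

theorem exists_perm_cons_of_count_eq_one {L X : Type*} [DecidableEq L]
    {l : List (L × X)} {a : L} (h : (l.map Prod.fst).count a = 1) :
    ∃ u r, l.Perm ((a, u) :: r) ∧ a ∉ r.map Prod.fst := by
  have ha : a ∈ l.map Prod.fst := List.count_pos_iff.1 (by omega)
  obtain ⟨⟨_, u⟩, hu, rfl⟩ := List.mem_map.1 ha
  obtain ⟨s, t, rfl⟩ := List.append_of_mem hu
  refine ⟨u, s ++ t, List.perm_middle, List.count_eq_zero.1 ?_⟩
  rw [(List.perm_middle.map _).count_eq, List.map_cons, List.count_cons_self] at h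
  omega

namespace DiagramCode

open Item

variable {L M X : Type} [SymmetricQuandle X]

theorem parametrizesColorings_strand (a b : L) :
    ParametrizesColorings [strand a b]
      (fun u : X => [strand (a, u) (b, rev u)])
      (fun u => [(a, u), (b, rev u)]) where
  injective u v h := by simpa using h
  colors u := colors_strand_cons.2 ⟨u, [], rfl, colors_nil_right.2 rfl⟩
  perm_allEnds u := ⟨[], .rfl⟩
  exists_lift_eq E hE _ := by
    simp only [colors_strand_cons, colors_nil_right] at hE
    obtain ⟨u, _, rfl, rfl⟩ := hE
    exact ⟨u, rfl⟩

theorem parametrizesColorings_strand_strand (x₁ x₂ y₁ y₂ : L) :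
    ParametrizesColorings [strand x₁ y₁, strand x₂ y₂]
      (fun u : X × X => [strand (x₁, u.1) (y₁, rev u.1), strand (x₂, u.2) (y₂, rev u.2)])
      (fun u => [(x₁, u.1), (y₁, rev u.1), (x₂, u.2), (y₂, rev u.2)]) where
  injective u v h := by simp_all [Prod.ext_iff]
  colors u := by simp [colors_strand_cons]
  perm_allEnds u := ⟨[], .rfl⟩
  exists_lift_eq E hE _ := by
    simp only [colors_strand_cons, colors_nil_right] at hE
    obtain ⟨u, _, rfl, v, _, rfl, rfl⟩ := hE
    exact ⟨(u, v), rfl⟩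

theorem parametrizesColorings_flip (a b : L) :
    ParametrizesColorings [strand b a]
      (fun u : X => [strand (b, rev u) (a, u)])
      (fun u => [(a, u), (b, rev u)]) where
  injective u v h := by simpa using h
  colors u := colors_strand_cons.2 ⟨rev u, [], by rw [rev_rev], colors_nil_right.2 rfl⟩
  perm_allEnds u := ⟨[], .swap _ _ _⟩
  exists_lift_eq E hE _ := by
    simp only [colors_strand_cons, colors_nil_right] at hE
    obtain ⟨u, _, rfl, rfl⟩ := hE
    exact ⟨rev u, by rw [rev_rev]⟩

theorem parametrizesColorings_crossing (a b c d : L) :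
    ParametrizesColorings [crossing a b c d]
      (fun u : X × X => [crossing (a, u.1) (b, u.2) (c, rev (u.2 ◃ u.1)) (d, rev u.2)])
      (fun u => [(a, u.1), (b, u.2), (c, rev (u.2 ◃ u.1)), (d, rev u.2)]) where
  injective u v h := by simp_all [Prod.ext_iff]
  colors u := colors_crossing_cons.2 ⟨u.1, u.2, [], rfl, colors_nil_right.2 rfl⟩
  perm_allEnds u := ⟨[], .rfl⟩
  exists_lift_eq E hE _ := by
    simp only [colors_crossing_cons, colors_nil_right] at hE
    obtain ⟨u, v, _, rfl, rfl⟩ := hE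
    exact ⟨(u, v), rfl⟩

theorem parametrizesColorings_rotate (a b c d : L) :
    ParametrizesColorings [crossing c d a b]
      (fun u : X × X => [crossing (c, rev (u.2 ◃ u.1)) (d, rev u.2) (a, u.1) (b, u.2)])
      (fun u => [(a, u.1), (b, u.2), (c, rev (u.2 ◃ u.1)), (d, rev u.2)]) where
  injective u v h := by simp_all [Prod.ext_iff]
  colors u := colors_crossing_cons.2
    ⟨rev (u.2 ◃ u.1), rev u.2, [], by simp [act_rev], colors_nil_right.2 rfl⟩
  perm_allEnds u := ⟨[], List.perm_append_comm (l₁ := [_, _])⟩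
  exists_lift_eq E hE _ := by
    simp only [colors_crossing_cons, colors_nil_right] at hE
    obtain ⟨u, v, _, rfl, rfl⟩ := hE
    exact ⟨(rev (v ◃ u), rev v), by simp [act_rev]⟩

theorem parametrizesColorings_r1 (a c d : L) :
    ParametrizesColorings [crossing a a c d]
      (fun u : X => [crossing (a, rev u) (a, u) (c, u) (d, rev u)])
      (fun u => [(c, u), (d, rev u)]) where
  injective u v h := by simp_all
  colors u := colors_crossing_cons.2
    ⟨rev u, u, [], by simp [act_rev, Quandle.fix], colors_nil_right.2 rfl⟩
  perm_allEnds u := ⟨[(a, rev u)], by simp [ends, opposite]⟩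
  exists_lift_eq E hE hm := by
    simp only [colors_crossing_cons, colors_nil_right] at hE
    obtain ⟨u, v, _, rfl, rfl⟩ := hE
    obtain rfl : v = rev u := matches_of_getElem? hm (i := 0) (j := 1) (by decide) rfl rfl
    exact ⟨rev u, by simp⟩

theorem parametrizesColorings_r1' (a b d : L) :
    ParametrizesColorings [crossing a b b d]
      (fun u : X => [crossing (a, u) (b, u) (b, rev u) (d, rev u)])
      (fun u => [(a, u), (d, rev u)]) where
  injective u v h := by simp_all
  colors u := colors_crossing_cons.2 ⟨u, u, [], by rw [Quandle.fix], colors_nil_right.2 rfl⟩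
  perm_allEnds u := ⟨[(b, u)], by
    simpa [ends, opposite] using (List.perm_middle (l₁ := [(b, u), (b, rev u)]) (l₂ := [_])).symm⟩
  exists_lift_eq E hE hm := by
    simp only [colors_crossing_cons, colors_nil_right] at hE
    obtain ⟨u, v, _, rfl, rfl⟩ := hE
    have hvu : v ◃ u = v := rev_injective
      (matches_of_getElem? hm (i := 1) (j := 2) (by decide) rfl rfl)
    obtain rfl : u = v := Rack.left_cancel v |>.1 (hvu.trans Quandle.fix.symm)
    exact ⟨u, by simp only [Quandle.fix]⟩

theorem parametrizesColorings_r2 (x₁ x₂ y₁ y₂ u₁ u₂ : L) :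
    ParametrizesColorings [crossing x₁ x₂ u₂ u₁, crossing u₂ y₂ y₁ u₁]
      (fun u : X × X =>
        [crossing (x₁, u.1) (x₂, u.2) (u₂, rev (u.2 ◃ u.1)) (u₁, rev u.2),
          crossing (u₂, u.2 ◃ u.1) (y₂, rev u.2) (y₁, rev u.1) (u₁, u.2)])
      (fun u => [(x₁, u.1), (y₁, rev u.1), (x₂, u.2), (y₂, rev u.2)]) where
  injective u v h := by simp_all [Prod.ext_iff]
  colors u := by
    simp [colors_crossing_cons]
  perm_allEnds u := ⟨[(u₂, rev (u.2 ◃ u.1)), (u₁, rev u.2)], by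
    simp only [allEnds_cons, ends, List.map_cons, List.map_nil, opposite_mk, rev_rev,
      List.cons_append, List.nil_append, ← Multiset.coe_eq_coe, ← Multiset.cons_coe,
      ← Multiset.singleton_add]
    abel⟩
  exists_lift_eq E hE hm := by
    simp only [colors_crossing_cons, colors_nil_right] at hE
    obtain ⟨u, v, _, rfl, w, z, _, rfl, rfl⟩ := hE
    have hw := matches_of_getElem? hm (i := 2) (j := 4) (by decide) rfl rfl
    have hz := matches_of_getElem? hm (i := 3) (j := 7) (by decide) rfl rfl
    simp only [rev_rev] at hw hz
    subst hw hz
    exact ⟨(u, rev z), by simp⟩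

theorem parametrizesColorings_r3_left (x₁ x₂ x₃ y₁ y₂ y₃ u₁ u₂ v : L) :
    ParametrizesColorings
      [crossing x₁ x₂ u₂ u₁, crossing u₂ x₃ y₃ v, crossing u₁ v y₂ y₁]
      (fun (a, b, c) =>
        [crossing (x₁, a) (x₂, b) (u₂, rev (b ◃ a)) (u₁, rev b),
          crossing (u₂, b ◃ a) (x₃, c) (y₃, rev (c ◃ (b ◃ a))) (v, rev c),
          crossing (u₁, b) (v, c) (y₂, rev (c ◃ b)) (y₁, (rev c : X))])
      (fun (a, b, c) => [(x₁, a), (x₂, b), (x₃, c),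
        (y₁, rev c), (y₂, rev (c ◃ b)), (y₃, rev (c ◃ (b ◃ a)))]) where
  injective u v h := by simp_all [Prod.ext_iff]
  colors u := by simp [colors_crossing_cons]
  perm_allEnds := fun (a, b, c) => ⟨[(u₂, rev (b ◃ a)), (u₁, rev b), (v, rev c)], by
    simp only [allEnds_cons, ends, List.map_cons, List.map_nil, opposite_mk, rev_rev,
      List.cons_append, List.nil_append, ← Multiset.coe_eq_coe, ← Multiset.cons_coe,
      ← Multiset.singleton_add]
    abel⟩
  exists_lift_eq E hE hm := by
    simp only [colors_crossing_cons, colors_nil_right] at hE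
    obtain ⟨a, b, _, rfl, d, c, _, rfl, e, f, _, rfl, rfl⟩ := hE
    have hd := matches_of_getElem? hm (i := 2) (j := 4) (by decide) rfl rfl
    have he := matches_of_getElem? hm (i := 3) (j := 8) (by decide) rfl rfl
    have hf := matches_of_getElem? hm (i := 7) (j := 9) (by decide) rfl rfl
    simp only [rev_rev] at hd he hf
    subst hd he hf
    exact ⟨(a, e, f), rfl⟩

theorem parametrizesColorings_r3_right (x₁ x₂ x₃ y₁ y₂ y₃ s₂ s₃ t : L) :
    ParametrizesColorings
      [crossing x₂ x₃ s₃ s₂, crossing x₁ s₂ t y₁, crossing t s₃ y₃ y₂]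
      (fun (a, b, c) =>
        [crossing (x₂, b) (x₃, c) (s₃, rev (c ◃ b)) (s₂, rev c),
          crossing (x₁, a) (s₂, c) (t, rev (c ◃ a)) (y₁, rev c),
          crossing (t, c ◃ a) (s₃, c ◃ b) (y₃, rev (c ◃ (b ◃ a))) (y₂, (rev (c ◃ b) : X))])
      (fun (a, b, c) => [(x₁, a), (x₂, b), (x₃, c),
        (y₁, rev c), (y₂, rev (c ◃ b)), (y₃, rev (c ◃ (b ◃ a)))]) where
  injective u v h := by simp_all [Prod.ext_iff]
  colors u := by simp [colors_crossing_cons, ← Shelf.self_distrib]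
  perm_allEnds := fun (a, b, c) => ⟨[(s₃, rev (c ◃ b)), (s₂, rev c), (t, rev (c ◃ a))], by
    simp only [allEnds_cons, ends, List.map_cons, List.map_nil, opposite_mk, rev_rev,
      List.cons_append, List.nil_append, ← Multiset.coe_eq_coe, ← Multiset.cons_coe,
      ← Multiset.singleton_add]
    abel⟩
  exists_lift_eq E hE hm := by
    simp only [colors_crossing_cons, colors_nil_right] at hE
    obtain ⟨b, c, _, rfl, a, d, _, rfl, e, f, _, rfl, rfl⟩ := hE
    have hd := matches_of_getElem? hm (i := 3) (j := 5) (by decide) rfl rfl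
    have he := matches_of_getElem? hm (i := 6) (j := 8) (by decide) rfl rfl
    have hf := matches_of_getElem? hm (i := 2) (j := 9) (by decide) rfl rfl
    simp only [rev_rev] at hd he hf
    subst hd he hf
    exact ⟨(a, b, d), by simp only [← Shelf.self_distrib]⟩

theorem parametrizesColorings_r3'_left (x₁ x₂ x₃ y₁ y₂ y₃ u₁ u₂ v : L) :
    ParametrizesColorings
      [crossing x₂ u₂ u₁ x₁, crossing x₃ y₃ v u₂, crossing v y₂ y₁ u₁]
      (fun (a, b, c) =>
        [crossing (x₂, rev b) (u₂, a) (u₁, a ◃ b) (x₁, rev a),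
          crossing (x₃, c) (y₃, a) (v, rev (a ◃ c)) (u₂, rev a),
          crossing (v, a ◃ c) (y₂, a ◃ b) (y₁, rev (a ◃ (b ◃ c))) (u₁, (rev (a ◃ b) : X))])
      (fun (a, b, c) => [(x₁, rev a), (x₂, rev b), (x₃, c),
        (y₁, rev (a ◃ (b ◃ c))), (y₂, a ◃ b), (y₃, a)]) where
  injective u v h := by simp_all [Prod.ext_iff]
  colors u := by simp [colors_crossing_cons, act_rev, ← Shelf.self_distrib]
  perm_allEnds := fun (a, b, c) => ⟨[(u₂, a), (u₁, a ◃ b), (v, rev (a ◃ c))], by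
    simp only [allEnds_cons, ends, List.map_cons, List.map_nil, opposite_mk, rev_rev,
      List.cons_append, List.nil_append, ← Multiset.coe_eq_coe, ← Multiset.cons_coe,
      ← Multiset.singleton_add]
    abel⟩
  exists_lift_eq E hE hm := by
    simp only [colors_crossing_cons, colors_nil_right] at hE
    obtain ⟨b, a, _, rfl, c, d, _, rfl, e, f, _, rfl, rfl⟩ := hE
    have hd := matches_of_getElem? hm (i := 1) (j := 7) (by decide) rfl rfl
    have he := matches_of_getElem? hm (i := 6) (j := 8) (by decide) rfl rfl
    have hf := matches_of_getElem? hm (i := 2) (j := 11) (by decide) rfl rfl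
    simp only [rev_rev, rev_inj] at hd he hf
    rw [rev_eq_comm, ← act_rev] at hf
    subst hd he hf
    exact ⟨(d, rev b, c), by simp [← act_rev, ← Shelf.self_distrib]⟩

theorem parametrizesColorings_r3'_right (x₁ x₂ x₃ y₁ y₂ y₃ s₂ s₃ t : L) :
    ParametrizesColorings
      [crossing x₃ s₃ s₂ x₂, crossing s₂ t y₁ x₁, crossing s₃ y₃ y₂ t]
      (fun (a, b, c) =>
        [crossing (x₃, c) (s₃, b) (s₂, rev (b ◃ c)) (x₂, rev b),
          crossing (s₂, b ◃ c) (t, a) (y₁, rev (a ◃ (b ◃ c))) (x₁, rev a),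
          crossing (s₃, rev b) (y₃, a) (y₂, a ◃ b) (t, (rev a : X))])
      (fun (a, b, c) => [(x₁, rev a), (x₂, rev b), (x₃, c),
        (y₁, rev (a ◃ (b ◃ c))), (y₂, a ◃ b), (y₃, a)]) where
  injective u v h := by simp_all [Prod.ext_iff]
  colors u := by simp [colors_crossing_cons, act_rev]
  perm_allEnds := fun (a, b, c) => ⟨[(s₃, b), (s₂, rev (b ◃ c)), (t, a)], by
    simp only [allEnds_cons, ends, List.map_cons, List.map_nil, opposite_mk, rev_rev,
      List.cons_append, List.nil_append, ← Multiset.coe_eq_coe, ← Multiset.cons_coe,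
      ← Multiset.singleton_add]
    abel⟩
  exists_lift_eq E hE hm := by
    simp only [colors_crossing_cons, colors_nil_right] at hE
    obtain ⟨c, b, _, rfl, d, a, _, rfl, e, f, _, rfl, rfl⟩ := hE
    have hd := matches_of_getElem? hm (i := 2) (j := 4) (by decide) rfl rfl
    have he := matches_of_getElem? hm (i := 1) (j := 8) (by decide) rfl rfl
    have hf := matches_of_getElem? hm (i := 5) (j := 11) (by decide) rfl rfl
    simp only [rev_rev, rev_inj] at hd he hf
    subst hd he hf
    exact ⟨(f, b, c), by simp [act_rev]⟩

theorem card_coloring_perm {D D' : DiagramCode L} (h : D.Perm D') :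
    Nat.card (Coloring X D) = Nat.card (Coloring X D') := by
  obtain ⟨φ, hperm, hφ⟩ := exists_equiv_lifts_of_perm (mapEnds (Prod.fst : L × X → L)) h
  exact Nat.card_congr <| φ.subtypeEquiv fun E =>
    and_congr (and_congr (hφ E).symm (by simp only [(hperm E).mem_iff]))
      ((perm_allEnds (hperm E)).pairwise_iff Matches.symm).symm

theorem existsUnique_colors_mapEnds (f : L → M) {D : DiagramCode L} {F' : DiagramCode (M × X)}
    (hF' : F'.Colors (D.map (mapEnds f))) :
    ∃! F : DiagramCode (L × X), F.Colors D ∧ F.map (mapEnds (Prod.map f id)) = F' := by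
  induction D generalizing F' with
  | nil =>
    rw [List.map_nil, colors_nil_right] at hF'
    subst hF'
    exact ⟨[], by simp, by simp⟩
  | cons i D ih =>
    cases i with
    | strand a b =>
      obtain ⟨x, G', rfl, hG'⟩ := colors_strand_cons.1 hF'
      obtain ⟨G, ⟨hG, rfl⟩, hunique⟩ := ih hG'
      refine ⟨strand (a, x) (b, rev x) :: G, ⟨colors_strand_cons.2 ⟨x, G, rfl, hG⟩, rfl⟩, ?_⟩
      rintro H ⟨hH, hH'⟩
      obtain ⟨y, H, rfl, hG'⟩ := colors_strand_cons.1 hH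
      obtain ⟨h, hHG⟩ := List.cons.inj hH'
      obtain rfl : y = x := by simpa [mapEnds] using h
      rw [hunique H ⟨hG', hHG⟩]
    | crossing a b c d =>
      obtain ⟨x, y, G', rfl, hG'⟩ := colors_crossing_cons.1 hF'
      obtain ⟨G, ⟨hG, rfl⟩, hunique⟩ := ih hG'
      refine ⟨_, ⟨colors_crossing_cons.2 ⟨x, y, G, rfl, hG⟩, rfl⟩, ?_⟩
      rintro H ⟨hH, hH'⟩
      obtain ⟨x', y', H, rfl, hG'⟩ := colors_crossing_cons.1 hH
      obtain ⟨h, hHG⟩ := List.cons.inj hH'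
      obtain ⟨rfl, rfl⟩ : x' = x ∧ y' = y := by simp_all [mapEnds]
      rw [hunique H ⟨hG', hHG⟩]

theorem Colors.mapEnds {f : L → M} {D : DiagramCode L} {F : DiagramCode (L × X)}
    (hF : F.Colors D) : Colors (F.map (mapEnds (Prod.map f id))) (D.map (mapEnds f)) := by
  refine ⟨?_, List.forall_mem_map.2 fun i hi => ?_⟩
  · rw [← hF.1, List.map_map, List.map_map]
    exact List.map_congr_left fun i _ => by cases i <;> rfl
  · have := hF.2 i hi
    cases i <;> exact this

theorem eq_of_pairwise_cons {a : L} {l : List (L × X)} {u v : X}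
    (ha : a ∈ l.map Prod.fst) (hu : ((a, u) :: l).Pairwise Matches)
    (hv : ((a, v) :: l).Pairwise Matches) : u = v := by
  obtain ⟨e, he, rfl⟩ := List.mem_map.1 ha
  rw [← rev_inj, ← List.rel_of_pairwise_cons hu he rfl, List.rel_of_pairwise_cons hv he rfl]

section

variable [DecidableEq L] {a b : L} {l : List (L × X)}

theorem exists_pairwise_strand_iff (hab : a ≠ b) (ha : (l.map Prod.fst).count a = 1)
    (hb : (l.map Prod.fst).count b = 1) :
    (∃ x, ((a, x) :: (b, rev x) :: l).Pairwise Matches) ↔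
      (l.map (Prod.map (fun x => if x = b then a else x) id)).Pairwise Matches := by
  obtain ⟨u, l', hl', ha'⟩ := exists_perm_cons_of_count_eq_one ha
  rw [(hl'.map _).count_eq, List.map_cons, List.count_cons_of_ne hab] at hb
  obtain ⟨v, r, hr, hb'⟩ := exists_perm_cons_of_count_eq_one hb
  rw [(hr.map _).mem_iff, List.map_cons, List.mem_cons, not_or] at ha'
  have hl : l.Perm ((a, u) :: (b, v) :: r) := hl'.trans (hr.cons _)
  have hra : ∀ e ∈ r, a ≠ e.1 := fun e he h => ha'.2 (h ▸ List.mem_map_of_mem he)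
  have hrb : ∀ e ∈ r, b ≠ e.1 := fun e he h => hb' (h ▸ List.mem_map_of_mem he)
  have hid : r.map (Prod.map (fun x => if x = b then a else x) id) = r := by
    conv_rhs => rw [← r.map_id]
    exact List.map_congr_left fun e he => Prod.ext (if_neg (hrb e he).symm) rfl
  simp only [((hl.cons _).cons _).pairwise_iff Matches.symm,
    (hl.map _).pairwise_iff Matches.symm, List.map_cons, hid]
  have huv : u = rev v ↔ v = rev u := by rw [eq_comm, rev_eq_comm, eq_comm]
  simp +contextual [Matches, hab, hab.symm, hra, hrb, huv]

theorem card_coloring_absorb (hab : a ≠ b) {D : DiagramCode L}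
    (h : Glued (strand a b :: D)) :
    Nat.card (Coloring X (strand a b :: D)) =
      Nat.card (Coloring X (D.map (Item.map fun x => if x = b then a else x))) := by
  have hcount : ∀ F : DiagramCode (L × X), F.Colors D →
      (F.allEnds.map Prod.fst).count a = 1 ∧ (F.allEnds.map Prod.fst).count b = 1 := by
    intro F hF
    have ha := h a (by simp [ends])
    have hb := h b (by simp [ends])
    simp only [allEnds_cons, ends, List.cons_append, List.nil_append, List.count_cons, beq_iff_eq,
      hab, hab.symm, if_true, if_false] at ha hb
    rw [hF.map_fst_allEnds]
    omega
  rw [map_eq_mapEnds]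
  refine ((parametrizesColorings_strand a b).card_coloring h).trans (Nat.card_congr
    (Equiv.ofBijective (fun xF => ⟨_, xF.2.1.mapEnds, ?_⟩) ⟨?_, ?_⟩))
  · obtain ⟨⟨x, F⟩, hF, hm⟩ := xF
    rw [allEnds_mapEnds]
    exact (exists_pairwise_strand_iff hab (hcount F hF).1 (hcount F hF).2).1 ⟨x, hm⟩
  · intro ⟨⟨x, F⟩, hF, hm⟩ ⟨⟨y, G⟩, hG, hm'⟩ hFG
    obtain rfl : F = G := (existsUnique_colors_mapEnds _ hF.mapEnds).unique ⟨hF, rfl⟩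
      ⟨hG, (congrArg Subtype.val hFG).symm⟩
    have ha : a ∈ F.allEnds.map Prod.fst := List.count_pos_iff.1 (by rw [(hcount F hF).1]; simp)
    obtain rfl : x = y := eq_of_pairwise_cons ha
      (hm.sublist ((List.sublist_cons_self _ _).cons_cons _))
      (hm'.sublist ((List.sublist_cons_self _ _).cons_cons _))
    rfl
  · rintro ⟨F', hF', hm⟩
    obtain ⟨F, ⟨hF, rfl⟩, -⟩ := existsUnique_colors_mapEnds _ hF'
    rw [allEnds_mapEnds] at hm
    obtain ⟨x, hx⟩ := (exists_pairwise_strand_iff hab (hcount F hF).1 (hcount F hF).2).2 hm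
    exact ⟨⟨(x, F), hF, hx⟩, rfl⟩

theorem card_coloring_of_move {D D' : DiagramCode L} (h : Move D D') (hD : D.Glued)
    (hD' : D'.Glued) : Nat.card (Coloring X D) = Nat.card (Coloring X D') := by
  cases h with
  | perm _ _ h => exact card_coloring_perm h
  | flip a b D =>
    exact (parametrizesColorings_strand a b).card_coloring_eq
      (parametrizesColorings_flip a b) hD hD'
  | rotate a b c d D =>
    exact (parametrizesColorings_crossing a b c d).card_coloring_eq
      (parametrizesColorings_rotate a b c d) hD hD'
  | absorb a b hab D => exact card_coloring_absorb hab hD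
  | r1 a c d D =>
    exact (parametrizesColorings_r1 a c d).card_coloring_eq
      (parametrizesColorings_strand c d) hD hD'
  | r1' a b d D =>
    exact (parametrizesColorings_r1' a b d).card_coloring_eq
      (parametrizesColorings_strand a d) hD hD'
  | r2 x₁ x₂ y₁ y₂ u₁ u₂ D =>
    exact (parametrizesColorings_r2 x₁ x₂ y₁ y₂ u₁ u₂).card_coloring_eq
      (parametrizesColorings_strand_strand x₁ x₂ y₁ y₂) hD hD'
  | r3 x₁ x₂ x₃ y₁ y₂ y₃ u₁ u₂ v s₂ s₃ t D =>
    exact (parametrizesColorings_r3_left x₁ x₂ x₃ y₁ y₂ y₃ u₁ u₂ v).card_coloring_eq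
      (parametrizesColorings_r3_right x₁ x₂ x₃ y₁ y₂ y₃ s₂ s₃ t) hD hD'
  | r3' x₁ x₂ x₃ y₁ y₂ y₃ u₁ u₂ v s₂ s₃ t D =>
    exact (parametrizesColorings_r3'_left x₁ x₂ x₃ y₁ y₂ y₃ u₁ u₂ v).card_coloring_eq
      (parametrizesColorings_r3'_right x₁ x₂ x₃ y₁ y₂ y₃ s₂ s₃ t) hD hD'

variable (X) in
theorem card_coloring_of_sameKnot {D D' : DiagramCode L} (h : SameKnot D D') :
    Nat.card (Coloring X D) = Nat.card (Coloring X D') := by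
  induction h with
  | rel _ _ h => exact card_coloring_of_move h.2.2 h.1.1 h.2.1.1
  | refl => rfl
  | symm _ _ _ ih => exact ih.symm
  | trans _ _ _ _ _ ih₁ ih₂ => exact ih₁.trans ih₂

end

end DiagramCode

/-! ### Colourings of the diagram `K` -/

namespace DiagramCode

open Item

variable {L M X : Type} [SymmetricQuandle X]

/-- Colours at the ends of a code that are read off from colours `c` of the labels: bits tell the
two ends at every label apart, and the colour is reversed at the ends with bit `true`. -/
def paintEnd (c : L → X) (z : L × Bool) : L × X := (z.1, bif z.2 then rev (c z.1) else c z.1)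

theorem matches_paintEnd (c : L → X) {z w : L × Bool} (h : z ≠ w) :
    Matches (paintEnd c z) (paintEnd c w) := by
  obtain ⟨x, i⟩ := z
  obtain ⟨y, j⟩ := w
  rintro ⟨⟩
  cases i <;> cases j <;> simp_all [paintEnd]

theorem paintEnd_eq_paintEnd_iff {c c' : L → X} {z : L × Bool} :
    paintEnd c z = paintEnd c' z ↔ c z.1 = c' z.1 := by
  obtain ⟨x, _ | _⟩ := z <;> simp [paintEnd]

theorem exists_eq_map_paintEnd [Nonempty X] {l : List (L × X)}
    {m : List (L × Bool)} (hm : m.Nodup) (hlm : l.map Prod.fst = m.map Prod.fst)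
    (hl : l.Pairwise Matches) : ∃ c : L → X, l = m.map (paintEnd c) := by
  classical
  induction m generalizing l with
  | nil => exact ⟨Classical.arbitrary _, List.map_eq_nil_iff.1 hlm⟩
  | cons z m ih =>
    obtain ⟨e, l, rfl, he, hlm⟩ := List.map_eq_cons_iff.1 hlm
    obtain ⟨hel, hl⟩ := List.pairwise_cons.1 hl
    obtain ⟨hzm, hm⟩ := List.nodup_cons.1 hm
    obtain ⟨c, rfl⟩ := ih hm hlm hl
    by_cases hz : ∃ w ∈ m, w.1 = z.1
    · obtain ⟨w, hw, hwz⟩ := hz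
      have hwe := Matches.symm (hel _ (List.mem_map_of_mem hw)) (hwz.trans he.symm)
      have hwz' := matches_paintEnd c (ne_of_mem_of_not_mem hw hzm) hwz
      obtain rfl : e = paintEnd c z := Prod.ext he (hwe.trans hwz'.symm)
      exact ⟨c, rfl⟩
    · obtain ⟨x, u⟩ := e
      obtain ⟨y, i⟩ := z
      obtain rfl : x = y := he
      refine ⟨Function.update c x (bif i then rev u else u), ?_⟩
      have hc : ∀ w ∈ m, w.1 ≠ x := fun w hw hwx => hz ⟨w, hw, hwx⟩
      rw [List.map_cons]
      congr 1
      · cases i <;> simp [paintEnd]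
      · exact List.map_congr_left fun w hw => by simp [paintEnd, hc w hw]

/-- The code whose ends are coloured by `paintEnd`. -/
def paint (c : L → X) (U : DiagramCode (L × Bool)) : DiagramCode (L × X) :=
  U.map (mapEnds (paintEnd c))

theorem map_fst_paint (c : L → X) (U : DiagramCode (L × Bool)) :
    (U.paint c).map (mapEnds Prod.fst) = U.map (mapEnds Prod.fst) := by
  rw [paint, List.map_map]
  exact List.map_congr_left fun i _ => by cases i <;> rfl

theorem eq_of_map_mapEnds_eq {f : L → M} {E E' : DiagramCode L}
    (h : E.map (mapEnds f) = E'.map (mapEnds f)) (hends : E.allEnds = E'.allEnds) : E = E' := by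
  induction E generalizing E' with
  | nil => exact (List.map_eq_nil_iff.1 h.symm).symm
  | cons i E ih =>
    obtain ⟨j, E', rfl, hj, hE⟩ := List.map_eq_cons_iff.1 h.symm
    have hlen : i.ends.length = j.ends.length := by
      rw [← i.ends.length_map (f := f), ← j.ends.length_map (f := f), ← ends_mapEnds,
        ← ends_mapEnds, hj]
    obtain ⟨hi, hE'⟩ := List.append_inj hends hlen
    rw [ih hE.symm hE']
    cases i <;> cases j <;> simp_all [ends]

theorem pairwise_matches_iff_exists_eq_paint [Nonempty X]
    {U : DiagramCode (L × Bool)} (hU : U.allEnds.Nodup) {E : DiagramCode (L × X)}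
    (hE : E.map (mapEnds Prod.fst) = U.map (mapEnds Prod.fst)) :
    E.allEnds.Pairwise Matches ↔ ∃ c : L → X, E = U.paint c := by
  constructor
  · intro h
    obtain ⟨c, hc⟩ := exists_eq_map_paintEnd hU
      (by rw [← allEnds_mapEnds, hE, allEnds_mapEnds]) h
    exact ⟨c, eq_of_map_mapEnds_eq (hE.trans (map_fst_paint c U).symm)
      (by rw [hc, paint, allEnds_mapEnds])⟩
  · rintro ⟨c, rfl⟩
    rw [paint, allEnds_mapEnds, List.pairwise_map]
    exact hU.imp (matches_paintEnd c)

theorem paint_eq_paint_iff {c c' : L → X} {U : DiagramCode (L × Bool)} :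
    U.paint c = U.paint c' ↔ ∀ z ∈ U.allEnds, c z.1 = c' z.1 := by
  have hends : (U.paint c).allEnds = (U.paint c').allEnds ↔
      ∀ z ∈ U.allEnds, c z.1 = c' z.1 := by
    simp only [paint, allEnds_mapEnds, List.map_inj_left, paintEnd_eq_paintEnd_iff]
  rw [← hends]
  exact ⟨congrArg allEnds, eq_of_map_mapEnds_eq <|
    (map_fst_paint c U).trans (map_fst_paint c' U).symm⟩

end DiagramCode

namespace SymmetricQuandle

variable {X : Type*} [SymmetricQuandle X]

/-- The effect of a positive half twist on the colours of two parallel strands, both taken for the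
direction along the row of half twists. -/
def halfTwist : Equiv.Perm (X × X) where
  toFun u := (u.2, u.2 ◃ u.1)
  invFun u := (u.1 ◃⁻¹ u.2, u.1)
  left_inv u := by simp [Rack.invAct_act_eq]
  right_inv u := by simp [Rack.act_invAct_eq]

theorem halfTwist_apply (u : X × X) : halfTwist u = (u.2, u.2 ◃ u.1) := rfl

theorem halfTwist_inv_apply (u : X × X) : halfTwist⁻¹ u = (u.1 ◃⁻¹ u.2, u.1) := rfl

end SymmetricQuandle

namespace Girth3

open Item DiagramCode TreeEdge

/-- A row of half twists, where bits tell the two ends at every cut point apart. -/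
def twistEnds (e : TreeEdge) (n : ℤ) : DiagramCode (CutPoint × Bool) :=
  (List.range n.natAbs).map fun j =>
    if 0 < n then crossing (lt e j, false) (rt e j, false) (rt e (j + 1), true) (lt e (j + 1), true)
    else crossing (rt e j, false) (rt e (j + 1), true) (lt e (j + 1), true) (lt e j, false)

/-- The arcs between the rows of half twists, where bits tell the two ends at every cut point
apart. -/
def arcEnds (n : TreeEdge → ℤ) : DiagramCode (CutPoint × Bool) :=
  [ strand (lt p 0, true) (rt q 0, true), strand (lt q 0, true) (rt r 0, true),
    strand (lt r 0, true) (rt p 0, true), strand (lt a 0, true) (rt c 0, true),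
    strand (lt b 0, true) (rt a 0, true), strand (lt c 0, true) (rt b 0, true),
    strand (lt p (n p).natAbs, false) (lt a (n a).natAbs, false),
    strand (rt q (n q).natAbs, false) (rt a (n a).natAbs, false),
    strand (lt q (n q).natAbs, false) (lt b (n b).natAbs, false),
    strand (rt r (n r).natAbs, false) (rt b (n b).natAbs, false),
    strand (lt r (n r).natAbs, false) (lt c (n c).natAbs, false),
    strand (rt p (n p).natAbs, false) (rt c (n c).natAbs, false) ]

/-- The diagram `K`, where bits tell the two ends at every cut point apart. -/
def kEnds (n : TreeEdge → ℤ) : DiagramCode (CutPoint × Bool) :=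
  ([p, q, r, a, b, c].flatMap fun e => twistEnds e (n e)) ++ arcEnds n

theorem map_fst_twistEnds (e : TreeEdge) (n : ℤ) :
    (twistEnds e n).map (mapEnds Prod.fst) = twist e n := by
  simp only [twistEnds, twist, List.map_map]
  refine List.map_congr_left fun j _ => ?_
  simp only [Function.comp_apply]
  split_ifs <;> rfl

theorem map_fst_kEnds (n : TreeEdge → ℤ) :
    (kEnds n).map (mapEnds Prod.fst) = K (n p) (n q) (n r) (n a) (n b) (n c) := by
  simp [kEnds, K, arcEnds, mapEnds, map_fst_twistEnds]

theorem mem_allEnds_twistEnds {e : TreeEdge} {n : ℤ} {z : CutPoint × Bool}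
    (hz : z ∈ (twistEnds e n).allEnds) :
    z.1.edge = e ∧ z.1.level ≤ n.natAbs ∧
      if z.2 then 0 < z.1.level else z.1.level < n.natAbs := by
  simp only [allEnds, twistEnds, List.flatMap_map, List.mem_flatMap, List.mem_range] at hz
  obtain ⟨j, hj, hz⟩ := hz
  split_ifs at hz <;> simp only [ends, List.mem_cons, List.not_mem_nil, or_false] at hz <;>
    rcases hz with rfl | rfl | rfl | rfl <;> grind [lt, rt]

theorem nodup_allEnds_twistEnds (e : TreeEdge) (n : ℤ) : (twistEnds e n).allEnds.Nodup := by
  simp only [allEnds, twistEnds, List.flatMap_map]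
  refine List.nodup_flatMap.2 ⟨fun j _ => ?_, ?_⟩
  · split_ifs <;> simp [ends, lt, rt]
  · refine List.nodup_range.imp fun {j k} hjk => ?_
    rw [Function.onFun, List.disjoint_left]
    intro z hz hz'
    split_ifs at hz hz' <;>
      simp only [ends, List.mem_cons, List.not_mem_nil, or_false] at hz hz' <;>
      rcases hz with rfl | rfl | rfl | rfl <;> grind [lt, rt]

theorem mem_allEnds_arcEnds {n : TreeEdge → ℤ} {z : CutPoint × Bool}
    (hz : z ∈ (arcEnds n).allEnds) :
    z.1.level = if z.2 then 0 else (n z.1.edge).natAbs := by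
  revert z
  simp only [arcEnds, allEnds_cons, allEnds_nil, ends, List.cons_append, List.nil_append,
    List.forall_mem_cons]
  simp [lt, rt]

theorem nodup_allEnds_kEnds (n : TreeEdge → ℤ) : (kEnds n).allEnds.Nodup := by
  have h : allEnds ([p, q, r, a, b, c].flatMap fun e => twistEnds e (n e)) =
      [p, q, r, a, b, c].flatMap fun e => (twistEnds e (n e)).allEnds := by
    simp [allEnds]
  rw [kEnds, allEnds_append, List.nodup_append, h]
  refine ⟨List.nodup_flatMap.2 ⟨fun e _ => nodup_allEnds_twistEnds e _, ?_⟩, ?_, ?_⟩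
  · have hnodup : [p, q, r, a, b, c].Nodup := by decide
    refine hnodup.imp fun {e e'} hee => ?_
    rw [Function.onFun, List.disjoint_left]
    intro z hz hz'
    exact hee ((mem_allEnds_twistEnds hz).1.symm.trans (mem_allEnds_twistEnds hz').1)
  · refine List.Nodup.of_map (fun z => (z.1.edge, z.1.left, z.2)) ?_
    simp only [arcEnds, allEnds_cons, allEnds_nil, ends, List.cons_append, List.nil_append,
      List.map_cons, List.map_nil, lt, rt]
    decide
  · rintro z hz _ hz' rfl
    obtain ⟨e, -, hz⟩ := List.mem_flatMap.1 hz
    obtain ⟨rfl, -, hlevel⟩ := mem_allEnds_twistEnds hz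
    rw [mem_allEnds_arcEnds hz'] at hlevel
    split_ifs at hlevel <;> omega

theorem level_le_of_mem_allEnds_kEnds {n : TreeEdge → ℤ} {z : CutPoint × Bool}
    (hz : z ∈ (kEnds n).allEnds) : z.1.level ≤ (n z.1.edge).natAbs := by
  simp only [kEnds, allEnds_append, List.mem_append] at hz
  obtain hz | hz := hz
  · simp only [allEnds, List.mem_flatMap] at hz
    obtain ⟨i, ⟨e, -, hi⟩, hz⟩ := hz
    obtain ⟨rfl, hlevel, -⟩ := mem_allEnds_twistEnds (List.mem_flatMap.2 ⟨i, hi, hz⟩)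
    exact hlevel
  · rw [mem_allEnds_arcEnds hz]
    split_ifs <;> simp

theorem mem_allEnds_kEnds_of_level_eq_zero (n : TreeEdge → ℤ) {z : CutPoint} (hz : z.level = 0) :
    (z, true) ∈ (kEnds n).allEnds := by
  obtain ⟨_ | _, _ | _, _⟩ := z <;> cases hz <;> simp [kEnds, arcEnds, ends, lt, rt]

/-- The relations imposed by the arcs of the diagram on the colours at the starts `x` and
at the ends `y` of the rows of half twists, where `ι` is the reversal of colours. -/
def ArcRelations {X : Type*} (ι : X → X) (x y : TreeEdge → X × X) : Prop :=
  (ι (x q).2 = (x p).1 ∧ ι (x r).2 = (x q).1 ∧ ι (x p).2 = (x r).1) ∧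
    (ι (x c).2 = (x a).1 ∧ ι (x a).2 = (x b).1 ∧ ι (x b).2 = (x c).1) ∧
    ((y a).1 = ι (y p).1 ∧ (y a).2 = ι (y q).2) ∧
    ((y b).1 = ι (y q).1 ∧ (y b).2 = ι (y r).2) ∧
    (y c).1 = ι (y r).1 ∧ (y c).2 = ι (y p).2

variable {X : Type} [SymmetricQuandle X]

/-- The colours on the left and on the right of `e` after `j` half twists. -/
def level (f : CutPoint → X) (e : TreeEdge) (j : ℕ) : X × X := (f (lt e j), f (rt e j))

theorem colored_twistEnds_iff {f : CutPoint → X} {e : TreeEdge} {n : ℤ} :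
    (∀ i ∈ (twistEnds e n).paint f, i.Colored) ↔
      ∀ j < n.natAbs, level f e (j + 1) = (halfTwist ^ n.sign) (level f e j) := by
  simp only [paint, twistEnds, List.map_map, List.forall_mem_map, List.mem_range]
  refine forall₂_congr fun j hj => ?_
  rcases lt_trichotomy n 0 with hn | rfl | hn
  · have hflip : f (lt e j) = f (rt e (j + 1)) ↔ f (rt e (j + 1)) = f (lt e j) := eq_comm
    simp +contextual [hn.not_gt, Int.sign_eq_neg_one_of_neg hn, halfTwist_inv_apply, mapEnds,
      Colored, level, paintEnd, rev_act, hflip, and_comm]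
  · simp at hj
  · simp [hn, Int.sign_eq_one_of_pos hn, halfTwist_apply, mapEnds, Colored, level, paintEnd]

theorem colored_arcEnds_iff {f : CutPoint → X} {n : TreeEdge → ℤ} :
    (∀ i ∈ (arcEnds n).paint f, i.Colored) ↔
      ArcRelations rev (level f · 0) (fun e => level f e (n e).natAbs) := by
  simp [arcEnds, paint, mapEnds, Colored, level, paintEnd, ArcRelations, and_assoc]

theorem colored_kEnds_iff {f : CutPoint → X} {n : TreeEdge → ℤ} :
    (∀ i ∈ (kEnds n).paint f, i.Colored) ↔
      (∀ e, ∀ j < (n e).natAbs, level f e (j + 1) = (halfTwist ^ (n e).sign) (level f e j)) ∧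
        ArcRelations rev (level f · 0) (fun e => level f e (n e).natAbs) := by
  have hmem : ∀ e, e ∈ [p, q, r, a, b, c] := fun e => by cases e <;> decide
  simp only [kEnds, paint, ← colored_twistEnds_iff, ← colored_arcEnds_iff, List.map_append,
    List.map_flatMap, List.forall_mem_append, List.mem_flatMap, hmem, true_and,
    forall_exists_index]
  exact and_congr_left' forall_comm

/-- The colours of all cut points, given the colours `x` at the starts of the rows of half
twists. -/
def spread (n : TreeEdge → ℤ) (x : TreeEdge → X × X) (z : CutPoint) : X :=
  let u := (halfTwist ^ ((n z.edge).sign * z.level)) (x z.edge)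
  bif z.left then u.1 else u.2

theorem level_spread (n : TreeEdge → ℤ) (x : TreeEdge → X × X) (e : TreeEdge) (j : ℕ) :
    level (spread n x) e j = (halfTwist ^ ((n e).sign * j)) (x e) := rfl

theorem eq_halfTwist_zpow_of_succ {u : ℕ → X × X} {s : ℤ} {m : ℕ}
    (h : ∀ j < m, u (j + 1) = (halfTwist ^ s) (u j)) {j : ℕ} (hj : j ≤ m) :
    u j = (halfTwist ^ (s * j)) (u 0) := by
  induction j with
  | zero => simp
  | succ j ih =>
    rw [h j hj, ih (by omega), ← Equiv.Perm.mul_apply, ← zpow_add]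
    congr 3
    push_cast
    ring

theorem colored_spread_iff {n : TreeEdge → ℤ} {x : TreeEdge → X × X} :
    (∀ i ∈ (kEnds n).paint (spread n x), i.Colored) ↔
      ArcRelations rev x (fun e => (halfTwist ^ n e) (x e)) := by
  have hsucc : ∀ e, ∀ j < (n e).natAbs, level (spread n x) e (j + 1) =
      (halfTwist ^ (n e).sign) (level (spread n x) e j) := fun e j _ => by
    rw [level_spread, level_spread, ← Equiv.Perm.mul_apply, ← zpow_add]
    push_cast
    ring_nf
  rw [colored_kEnds_iff, and_iff_right hsucc]
  simp only [level_spread, Int.sign_mul_natAbs, Nat.cast_zero, mul_zero, zpow_zero,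
    Equiv.Perm.coe_one, id]

theorem exists_spread_of_colored {n : TreeEdge → ℤ} {f : CutPoint → X}
    (h : ∀ i ∈ (kEnds n).paint f, i.Colored) :
    ∃ x, (kEnds n).paint f = (kEnds n).paint (spread n x) := by
  refine ⟨(level f · 0), paint_eq_paint_iff.2 fun z hz => ?_⟩
  have hlevel := eq_halfTwist_zpow_of_succ ((colored_kEnds_iff.1 h).1 z.1.edge)
    (level_le_of_mem_allEnds_kEnds hz)
  obtain ⟨⟨e, left, j⟩, i⟩ := z
  cases left
  · exact congrArg Prod.snd hlevel
  · exact congrArg Prod.fst hlevel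

theorem spread_injective {n : TreeEdge → ℤ} {x x' : TreeEdge → X × X}
    (h : (kEnds n).paint (spread n x) = (kEnds n).paint (spread n x')) : x = x' := by
  have hzero : ∀ z : CutPoint, z.level = 0 → spread n x z = spread n x' z := fun z hz =>
    paint_eq_paint_iff.1 h _ (mem_allEnds_kEnds_of_level_eq_zero n hz)
  funext e
  simpa [spread, lt, rt] using Prod.ext (hzero (lt e 0) rfl) (hzero (rt e 0) rfl)

theorem card_coloring_K [Nonempty X] (n : TreeEdge → ℤ) :
    Nat.card (Coloring X (K (n p) (n q) (n r) (n a) (n b) (n c))) =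
      Nat.card {x : TreeEdge → X × X // ArcRelations rev x fun e => (halfTwist ^ n e) (x e)} := by
  have hfst (f : CutPoint → X) : ((kEnds n).paint f).map (mapEnds Prod.fst) = _ :=
    (map_fst_paint f _).trans (map_fst_kEnds n)
  symm
  refine Nat.card_congr (Equiv.ofBijective (fun x => ⟨(kEnds n).paint (spread n x.1),
    ⟨hfst _, colored_spread_iff.2 x.2⟩,
    (pairwise_matches_iff_exists_eq_paint (nodup_allEnds_kEnds n) (map_fst_paint _ _)).2
      ⟨_, rfl⟩⟩) ⟨?_, ?_⟩)
  · exact fun x x' h => Subtype.ext (spread_injective (congrArg Subtype.val h))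
  · rintro ⟨E, ⟨hE, hcolored⟩, hmatches⟩
    obtain ⟨f, rfl⟩ := (pairwise_matches_iff_exists_eq_paint (nodup_allEnds_kEnds n)
      (hE.trans (map_fst_kEnds n).symm)).1 hmatches
    obtain ⟨x, hx⟩ := exists_spread_of_colored hcolored
    exact ⟨⟨x, colored_spread_iff.1 (hx ▸ hcolored)⟩, Subtype.ext hx.symm⟩

end Girth3

/-! ### Alexander quandles -/

/-- Colours of Alexander type: an element of a commutative ring and a direction.  The unit `t`
is the parameter of the Alexander quandle. -/
@[ext]
structure AlexanderColor {R : Type*} [CommRing R] (t : Rˣ) where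
  value : R
  direction : Bool

namespace AlexanderColor

variable {R : Type*} [CommRing R] {t : Rˣ}

/-- The scalar by which an arc of direction `i` acts, `t` or `t⁻¹`. -/
def scalar (t : Rˣ) (i : Bool) : Rˣ := bif i then t⁻¹ else t

@[simp] theorem scalar_not (t : Rˣ) (i : Bool) : scalar t (!i) = (scalar t i)⁻¹ := by
  cases i <;> simp [scalar]

instance : SymmetricQuandle (AlexanderColor t) where
  act x y := ⟨x.value + scalar t x.direction * (y.value - x.value), y.direction⟩
  self_distrib {x y z} := by
    ext
    · simp only [add_sub_add_left_eq_sub]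
      ring
    · rfl
  invAct x y := ⟨x.value + ↑(scalar t x.direction)⁻¹ * (y.value - x.value), y.direction⟩
  left_inv x y := by ext <;> simp
  right_inv x y := by ext <;> simp
  fix {x} := by ext <;> simp
  rev x := ⟨x.value, !x.direction⟩
  rev_rev x := by simp
  act_rev x y := rfl
  rev_act x y := by ext <;> simp

theorem act_def (x y : AlexanderColor t) :
    x ◃ y = ⟨x.value + scalar t x.direction * (y.value - x.value), y.direction⟩ := rfl

theorem rev_def (x : AlexanderColor t) : rev x = ⟨x.value, !x.direction⟩ := rfl

instance (t : Rˣ) : Nonempty (AlexanderColor t) := ⟨⟨0, false⟩⟩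

/-- A full twist adds this multiple of the difference of the values on two antiparallel strands to
both of them. -/
def weight (t : Rˣ) (i : Bool) : R := ↑(scalar t i)⁻¹ - 1

theorem weight_mul_weight_not (t : Rˣ) (i : Bool) :
    weight t i * weight t (!i) = 2 - t - ↑t⁻¹ := by
  cases i <;>
    simp only [weight, scalar, cond_false, cond_true, Bool.not_false, Bool.not_true, inv_inv] <;>
    linear_combination t.mul_inv

theorem direction_halfTwist_zpow_two_mul (x : AlexanderColor t × AlexanderColor t) (k : ℤ) :
    ((halfTwist ^ (2 * k)) x).map direction direction = x.map direction direction := by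
  have hsq (x : AlexanderColor t × AlexanderColor t) :
      ((halfTwist ^ (2 : ℤ)) x).map direction direction = x.map direction direction := rfl
  rw [zpow_mul]
  induction k generalizing x with
  | zero => rfl
  | succ k ih => rw [zpow_add_one, Equiv.Perm.mul_apply, ih, hsq]
  | pred k ih =>
    rw [zpow_sub_one, Equiv.Perm.mul_apply, ih, ← hsq, ← Equiv.Perm.mul_apply, mul_inv_cancel]
    rfl

/-- The effect of `k` full twists on the values on two antiparallel strands. -/
def shift (μ : R) (k : ℤ) (v : R × R) : R × R :=
  (v.1 + k * μ * (v.1 - v.2), v.2 + k * μ * (v.1 - v.2))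

theorem shift_zero (μ : R) (v : R × R) : shift μ 0 v = v := by simp [shift]

theorem shift_shift (μ : R) (j k : ℤ) (v : R × R) :
    shift μ j (shift μ k v) = shift μ (j + k) v := by
  ext <;> simp only [shift] <;> push_cast <;> ring

/-- Colours of two strands that are antiparallel. -/
def antiparallel (t : Rˣ) (i : Bool) (v : R × R) : AlexanderColor t × AlexanderColor t :=
  (⟨v.1, i⟩, ⟨v.2, !i⟩)

theorem halfTwist_zpow_antiparallel (i : Bool) (v : R × R) (k : ℤ) :
    (halfTwist ^ (2 * k)) (antiparallel t i v) = antiparallel t i (shift (weight t i) k v) := by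
  have hsq (v : R × R) : (halfTwist ^ (2 : ℤ)) (antiparallel t i v) =
      antiparallel t i (shift (weight t i) 1 v) := by
    change halfTwist (halfTwist _) = _
    ext <;> simp only [antiparallel, halfTwist_apply, act_def, scalar_not, sub_add_cancel_left,
      mul_neg, Units.mul_inv_cancel_left, neg_sub, shift, Int.cast_one, weight, one_mul] <;> ring
  have hsq_inv (v : R × R) : (halfTwist ^ (2 : ℤ))⁻¹ (antiparallel t i v) =
      antiparallel t i (shift (weight t i) (-1) v) := by
    rw [Equiv.Perm.inv_eq_iff_eq, hsq, shift_shift, add_neg_cancel, shift_zero]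
  rw [zpow_mul]
  induction k generalizing v with
  | zero => rw [zpow_zero, Equiv.Perm.one_apply, shift_zero]
  | succ k ih => rw [zpow_add_one, Equiv.Perm.mul_apply, hsq, ih, shift_shift]
  | pred k ih =>
    rw [zpow_sub_one, Equiv.Perm.mul_apply, hsq_inv, ih, shift_shift, ← sub_eq_add_neg]

end AlexanderColor

/-- The edges of the tree `T'`. -/
def TreeEdge.outer : TreeEdge → Bool
  | p | q | r => false
  | a | b | c => true

namespace Girth3

open TreeEdge DiagramCode AlexanderColor

theorem arcRelations_not_iff {d : TreeEdge → Bool × Bool} :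
    ArcRelations not d d ↔ ∃ s : Bool, d = fun e => (s ^^ e.outer, !(s ^^ e.outer)) := by
  constructor
  · intro h
    refine ⟨(d p).1, funext fun e => ?_⟩
    simp only [ArcRelations] at h
    cases e <;> ext <;> simp only [outer] <;> grind
  · rintro ⟨s, rfl⟩
    simp [ArcRelations, outer]

variable {R : Type*} [CommRing R] {t : Rˣ}

theorem arcRelations_rev_iff {x y : TreeEdge → AlexanderColor t × AlexanderColor t} :
    ArcRelations rev x y ↔
      ArcRelations id (fun e => (x e).map value value) (fun e => (y e).map value value) ∧
        ArcRelations not (fun e => (x e).map direction direction)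
          (fun e => (y e).map direction direction) := by
  simp only [ArcRelations, AlexanderColor.ext_iff, rev_def, Prod.map, id]
  tauto

/-- The colours with values `v` for one of the two orientations of `K` for which the
strands along every edge are antiparallel. -/
def orient (t : Rˣ) (s : Bool) (v : TreeEdge → R × R) (e : TreeEdge) :
    AlexanderColor t × AlexanderColor t :=
  antiparallel t (s ^^ e.outer) (v e)

theorem orient_inj {s s' : Bool} {v v' : TreeEdge → R × R} :
    orient t s v = orient t s' v' ↔ s = s' ∧ v = v' := by
  constructor
  · intro h
    have hdir := congrArg (fun x => (x p).1.direction) h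
    have hs : s = s' := by simpa [orient, antiparallel] using hdir
    refine ⟨hs, funext fun e => ?_⟩
    simpa [orient, antiparallel, hs, Prod.ext_iff] using congrFun h e
  · rintro ⟨rfl, rfl⟩
    rfl

theorem arcRelations_orient_iff {s : Bool} {v : TreeEdge → R × R} {k : TreeEdge → ℤ} :
    ArcRelations rev (orient t s v) (fun e => (halfTwist ^ (2 * k e)) (orient t s v e)) ↔
      ArcRelations id v fun e => shift (weight t (s ^^ e.outer)) (k e) (v e) := by
  simp only [orient, halfTwist_zpow_antiparallel, arcRelations_rev_iff]
  exact and_iff_left (arcRelations_not_iff.2 ⟨s, rfl⟩)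

theorem exists_eq_orient {x : TreeEdge → AlexanderColor t × AlexanderColor t} {k : TreeEdge → ℤ}
    (h : ArcRelations rev x fun e => (halfTwist ^ (2 * k e)) (x e)) : ∃ s v, x = orient t s v := by
  rw [arcRelations_rev_iff] at h
  simp only [direction_halfTwist_zpow_two_mul] at h
  obtain ⟨s, hs⟩ := arcRelations_not_iff.1 h.2
  refine ⟨s, fun e => (x e).map value value, funext fun e => ?_⟩
  obtain ⟨h₁, h₂⟩ : (x e).1.direction = (s ^^ e.outer) ∧ (x e).2.direction = !(s ^^ e.outer) :=
    Prod.ext_iff.1 (congrFun hs e)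
  exact Prod.ext (AlexanderColor.ext rfl h₁) (AlexanderColor.ext rfl h₂)

theorem card_arcRelations_rev (k : TreeEdge → ℤ) :
    Nat.card {x : TreeEdge → AlexanderColor t × AlexanderColor t //
        ArcRelations rev x fun e => (halfTwist ^ (2 * k e)) (x e)} =
      Nat.card (Σ s : Bool, {v : TreeEdge → R × R //
        ArcRelations id v fun e => shift (weight t (s ^^ e.outer)) (k e) (v e)}) := by
  symm
  refine Nat.card_congr (Equiv.ofBijective
    (fun sv => ⟨orient t sv.1 sv.2.1, arcRelations_orient_iff.2 sv.2.2⟩) ⟨?_, ?_⟩)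
  · rintro ⟨s, v, hv⟩ ⟨s', v', hv'⟩ h
    obtain ⟨rfl, rfl⟩ := orient_inj.1 (congrArg Subtype.val h)
    rfl
  · rintro ⟨x, hx⟩
    obtain ⟨s, v, rfl⟩ := exists_eq_orient hx
    exact ⟨⟨s, v, arcRelations_orient_iff.1 hx⟩, rfl⟩

end Girth3

/-- The endomorphism of `G ^ ι` that is given by an integer matrix. -/
def zmulVec {ι : Type*} [Fintype ι] (M : Matrix ι ι ℤ) (G : Type*) [AddCommGroup G] :
    (ι → G) →+ (ι → G) where
  toFun w i := ∑ j, M i j • w j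
  map_zero' := by simp only [Pi.zero_apply, smul_zero, Finset.sum_const_zero]; rfl
  map_add' w w' := by ext i; simp [smul_add, Finset.sum_add_distrib]

namespace Girth3

open TreeEdge DiagramCode AlexanderColor

/-- The system of linear equations for the differences of values across `CP` and `CQ`, in terms of
the numbers of full twists and of `ζ = t - 2 + t⁻¹`. -/
def systemMatrix (k : TreeEdge → ℤ) (ζ : ℤ) : Matrix (Fin 2) (Fin 2) ℤ :=
  !![1 + ζ * (k c * k p + k c * k r + k a * k p), ζ * (k c * k r - k a * k q);
     ζ * (k b * k r - k a * k p), 1 + ζ * (k b * k q + k b * k r + k a * k q)]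

variable {R : Type} [CommRing R]

theorem mem_ker_systemMatrix_iff {k : TreeEdge → ℤ} {ζ : ℤ} {w : Fin 2 → R} :
    w ∈ (zmulVec (systemMatrix k ζ) R).ker ↔
      (1 + ζ * (k c * k p + k c * k r + k a * k p)) * w 0 + ζ * (k c * k r - k a * k q) * w 1 = 0 ∧
      ζ * (k b * k r - k a * k p) * w 0 +
        (1 + ζ * (k b * k q + k b * k r + k a * k q)) * w 1 = 0 := by
  rw [AddMonoidHom.mem_ker, funext_iff]
  simp [zmulVec, systemMatrix]

/-- The values of a colouring of `K` with value `u` on the left of `CP` and differences `w` across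
`CP` and `CQ`.  Here `α`, `β` are the differences across `a`, `b`, and `y` is the value on the left
of `a`. -/
def valuesOf (μ : Bool → R) (k : TreeEdge → ℤ) (u : R) (w : Fin 2 → R) (e : TreeEdge) : R × R :=
  let α := μ false * (k p * w 0 - k q * w 1)
  let β := μ false * (k q * w 1 + k r * (w 0 + w 1))
  let y := u + k p * μ false * w 0 - k a * μ true * α
  match e with
  | p => (u, u - w 0)
  | q => (u + w 1, u)
  | r => (u - w 0, u + w 1)
  | a => (y, y - α)
  | b => (y - α, y - α - β)
  | c => (y - α - β, y)

variable {μ : Bool → R} {k : TreeEdge → ℤ} {ζ : ℤ}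

theorem arcRelations_valuesOf (hμ : μ false * μ true = -ζ) {u : R} {w : Fin 2 → R}
    (hw : w ∈ (zmulVec (systemMatrix k ζ) R).ker) :
    ArcRelations id (valuesOf μ k u w)
      fun e => shift (μ e.outer) (k e) (valuesOf μ k u w e) := by
  obtain ⟨h₀, h₁⟩ := mem_ker_systemMatrix_iff.1 hw
  have hE : μ true * (k a * (μ false * (k p * w 0 - k q * w 1)) -
      k b * (μ false * (k q * w 1 + k r * (w 0 + w 1)))) = -w 1 := by
    linear_combination h₁ + (k a * (k p * w 0 - k q * w 1) -
      k b * (k q * w 1 + k r * (w 0 + w 1))) * hμ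
  have hD : μ true * (k a * (μ false * (k p * w 0 - k q * w 1)) +
      k c * (μ false * (k p * w 0 + k r * (w 0 + w 1)))) = w 0 := by
    linear_combination -h₀ + (k a * (k p * w 0 - k q * w 1) +
      k c * (k p * w 0 + k r * (w 0 + w 1))) * hμ
  simp only [ArcRelations, valuesOf, shift, outer, id]
  refine ⟨⟨trivial, trivial, trivial⟩, ⟨trivial, trivial, trivial⟩, ⟨?_, ?_⟩, ⟨?_, ?_⟩, ?_, ?_⟩
  · ring
  · ring
  · linear_combination -hE
  · linear_combination -hE
  · linear_combination -hD
  · linear_combination -hD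

theorem differences_of_arcRelations {v : TreeEdge → R × R}
    (hv : ArcRelations id v fun e => shift (μ e.outer) (k e) (v e)) :
    (v a).1 - (v a).2 = μ false * (k p * ((v p).1 - (v p).2) - k q * ((v q).1 - (v q).2)) ∧
      (v b).1 - (v b).2 = μ false * (k q * ((v q).1 - (v q).2) +
        k r * ((v p).1 - (v p).2 + ((v q).1 - (v q).2))) := by
  simp only [ArcRelations, shift, outer, id] at hv
  obtain ⟨⟨hq, hr, hp⟩, -, ⟨e₁, e₂⟩, ⟨e₃, e₄⟩, -⟩ := hv
  constructor
  · linear_combination e₁ - e₂ - hq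
  · linear_combination e₃ - e₄ - hr + μ false * k r * (hp + hq + hr)

theorem differences_mem_ker (hμ : μ false * μ true = -ζ) {v : TreeEdge → R × R}
    (hv : ArcRelations id v fun e => shift (μ e.outer) (k e) (v e)) :
    ![(v p).1 - (v p).2, (v q).1 - (v q).2] ∈ (zmulVec (systemMatrix k ζ) R).ker := by
  obtain ⟨hα, hβ⟩ := differences_of_arcRelations hv
  simp only [ArcRelations, shift, outer, id] at hv
  obtain ⟨-, ⟨hc, ha, hb⟩, ⟨e₁, e₂⟩, ⟨e₃, -⟩, -, e₆⟩ := hv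
  rw [mem_ker_systemMatrix_iff]
  simp only [Matrix.cons_val_zero, Matrix.cons_val_one]
  set w₀ := (v p).1 - (v p).2
  set w₁ := (v q).1 - (v q).2
  constructor
  · linear_combination e₆ - e₁ - hc + μ true * k c * (ha + hb + hc) +
      μ true * (k a + k c) * hα + μ true * k c * hβ +
      (k a * (k p * w₀ - k q * w₁) + k c * (k p * w₀ + k r * (w₀ + w₁))) * hμ
  · linear_combination e₂ - e₃ - ha - μ true * k a * hα + μ true * k b * hβ -
      (k a * (k p * w₀ - k q * w₁) - k b * (k q * w₁ + k r * (w₀ + w₁))) * hμ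

theorem valuesOf_differences {v : TreeEdge → R × R}
    (hv : ArcRelations id v fun e => shift (μ e.outer) (k e) (v e)) :
    valuesOf μ k (v p).1 ![(v p).1 - (v p).2, (v q).1 - (v q).2] = v := by
  obtain ⟨hα, hβ⟩ := differences_of_arcRelations hv
  simp only [ArcRelations, shift, outer, id] at hv
  obtain ⟨⟨hq, hr, hp⟩, ⟨hc, ha, hb⟩, ⟨e₁, -⟩, -⟩ := hv
  have ha' : (v p).1 + k p * μ false * ((v p).1 - (v p).2) -
      k a * μ true * ((v a).1 - (v a).2) = (v a).1 := by
    linear_combination -e₁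
  funext e
  cases e <;> ext <;>
    simp only [valuesOf, Matrix.cons_val_zero, Matrix.cons_val_one, ← hα, ← hβ, ha']
  · ring
  · linear_combination -hq
  · exact hq.symm
  · linear_combination hp
  · linear_combination -hr - hq
  · ring
  · linear_combination ha
  · linear_combination ha
  · linear_combination ha + hb
  · exact hc.symm

/-- A colouring of `K` amounts to the value on the left of `CP` and a solution of the linear system
for the differences. -/
def arcRelationsEquiv (hμ : μ false * μ true = -ζ) :
    {v : TreeEdge → R × R //
      ArcRelations id v fun e => shift (μ e.outer) (k e) (v e)} ≃
    R × (zmulVec (systemMatrix k ζ) R).ker where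
  toFun v := ((v.1 p).1, ⟨_, differences_mem_ker hμ v.2⟩)
  invFun uw := ⟨valuesOf μ k uw.1 uw.2.1, arcRelations_valuesOf hμ uw.2.2⟩
  left_inv v := Subtype.ext (valuesOf_differences v.2)
  right_inv uw := by
    refine Prod.ext rfl (Subtype.ext (funext fun i => ?_))
    fin_cases i <;> simp [valuesOf]

theorem card_coloring_K_two_mul (t : Rˣ) {ζ : ℤ} (ht : (t + ↑t⁻¹ : R) = 2 + ζ)
    (k : TreeEdge → ℤ) :
    Nat.card (Coloring (AlexanderColor t)
        (K (2 * k p) (2 * k q) (2 * k r) (2 * k a) (2 * k b) (2 * k c))) =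
      2 * (Nat.card R * Nat.card (zmulVec (systemMatrix k ζ) R).ker) := by
  have hμ (s : Bool) : weight t (s ^^ false) * weight t (s ^^ true) = -ζ := by
    rw [Bool.xor_false, Bool.xor_true, weight_mul_weight_not]
    linear_combination -ht
  have e := (Equiv.sigmaCongrRight fun s =>
    arcRelationsEquiv (μ := fun o => weight t (s ^^ o)) (k := k) (hμ s)).trans
      (Equiv.sigmaEquivProd Bool _)
  rw [card_coloring_K fun e => 2 * k e, card_arcRelations_rev, Nat.card_congr e, Nat.card_prod,
    Nat.card_prod, Nat.card_eq_fintype_card, Fintype.card_bool]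

end Girth3

/-! ### Kernels of integer matrices -/

section

open Matrix

variable {ι : Type*} [Fintype ι] {m : ℕ}

theorem zmulVec_map (M : Matrix ι ι ℤ) {G H : Type*} [AddCommGroup G] [AddCommGroup H]
    (f : G →+ H) (w : ι → G) :
    zmulVec M H (f.compLeft ι w) = f.compLeft ι (zmulVec M G w) := by
  ext i
  simp [zmulVec]

theorem card_ker_zmulVec_of_addEquiv_pi {κ G H : Type*} [Fintype κ] [AddCommGroup G]
    [AddCommGroup H] (M : Matrix ι ι ℤ) (e : G ≃+ (κ → H)) :
    Nat.card (zmulVec M G).ker = Nat.card (zmulVec M H).ker ^ Fintype.card κ := by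
  have hker (w : ι → G) : w ∈ (zmulVec M G).ker ↔
      ∀ x, (fun i => e (w i) x) ∈ (zmulVec M H).ker := by
    have hx (x : κ) : zmulVec M H (fun i => e (w i) x) = fun i => e (zmulVec M G w i) x :=
      zmulVec_map M ((Pi.evalAddMonoidHom (fun _ => H) x).comp e.toAddMonoidHom) w
    simp only [AddMonoidHom.mem_ker, hx, funext_iff, Pi.zero_apply]
    rw [forall_comm]
    exact forall_congr' fun i => by rw [← e.map_eq_zero_iff, funext_iff]; rfl
  rw [← Nat.card_eq_fintype_card, ← Nat.card_fun]
  exact Nat.card_congr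
    { toFun w x := ⟨fun i => e (w.1 i) x, (hker _).1 w.2 x⟩
      invFun v := ⟨fun i => e.symm fun x => (v x).1 i, (hker _).2 (by simp)⟩
      left_inv w := by simp
      right_inv v := by simp }

variable [DecidableEq ι]

theorem index_range_zmulVec_int {M : Matrix ι ι ℤ} (hM : M.det ≠ 0) :
    (zmulVec M ℤ).range.index = M.det.natAbs := by
  have hinj : Function.Injective (zmulVec M ℤ) := mulVec_injective_of_det_ne_zero hM
  rw [AddSubgroup.index_eq_natAbs_det (Pi.basisFun ℤ ι) _
    ((Pi.basisFun ℤ ι).map (AddMonoidHom.ofInjective hinj).toIntLinearEquiv),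
    Module.Basis.det_apply]
  congr 2
  ext i j
  change (M *ᵥ Pi.basisFun ℤ ι j) i = M i j
  rw [Pi.basisFun_apply, mulVec_single_one, col_apply]

theorem natCast_smul_mem_range_zmulVec_int {M : Matrix ι ι ℤ} (hM : M.det ∣ m) (u : ι → ℤ) :
    (m : ℤ) • u ∈ (zmulVec M ℤ).range := by
  obtain ⟨c, hc⟩ := hM
  refine ⟨M.adjugate *ᵥ (c • u), ?_⟩
  change M *ᵥ _ = _
  rw [mulVec_mulVec, mul_adjugate, smul_mulVec, one_mulVec, smul_smul, hc]

theorem comap_range_zmulVec_zmod {M : Matrix ι ι ℤ} (hM : M.det ∣ m) :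
    (zmulVec M (ZMod m)).range.comap ((Int.castAddHom (ZMod m)).compLeft ι) =
      (zmulVec M ℤ).range := by
  ext z
  constructor
  · rintro ⟨w, hw⟩
    obtain ⟨w, rfl⟩ := (ZMod.intCast_surjective (n := m)).comp_left w
    have hz (i : ι) : (m : ℤ) ∣ (z - zmulVec M ℤ w) i := by
      rw [Pi.sub_apply, ← ZMod.intCast_eq_intCast_iff_dvd_sub]
      exact congrFun ((zmulVec_map M (Int.castAddHom (ZMod m)) w).symm.trans hw) i
    choose u hu using hz
    rw [← sub_add_cancel z (zmulVec M ℤ w), funext (f := z - zmulVec M ℤ w) hu]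
    exact add_mem (natCast_smul_mem_range_zmulVec_int hM u) ⟨w, rfl⟩
  · rintro ⟨w, rfl⟩
    exact ⟨_, zmulVec_map M (Int.castAddHom (ZMod m)) w⟩

theorem card_ker_zmulVec_zmod [NeZero m] {M : Matrix ι ι ℤ} (hM : M.det ∣ m) :
    Nat.card (zmulVec M (ZMod m)).ker = M.det.natAbs := by
  have hdet : M.det ≠ 0 := by
    rintro h
    exact NeZero.ne m (by simpa [h] using hM)
  have hsurj : Function.Surjective ((Int.castAddHom (ZMod m)).compLeft ι) :=
    ZMod.intCast_surjective.comp_left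
  rw [← AddSubgroup.index_range, ← AddSubgroup.index_comap_of_surjective _ hsurj,
    comap_range_zmulVec_zmod hM, index_range_zmulVec_int hdet]

end

/-! ### The Conway polynomial -/

/-- The generator of `S[t] / (t² - τ t + 1)` as a unit, so that `t + t⁻¹ = τ`. -/
def quadraticUnit {S : Type*} [CommRing S] (τ : S) : (QuadraticAlgebra S (-1) τ)ˣ where
  val := ⟨0, 1⟩
  inv := ⟨τ, -1⟩
  val_inv := by ext <;> simp [QuadraticAlgebra.re_one, QuadraticAlgebra.im_one]
  inv_val := by ext <;> simp [QuadraticAlgebra.re_one, QuadraticAlgebra.im_one]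

theorem quadraticUnit_add_inv {S : Type*} [CommRing S] (ζ : ℤ) :
    (quadraticUnit (2 + ζ : S) + ↑(quadraticUnit (2 + ζ : S))⁻¹ :
      QuadraticAlgebra S (-1) (2 + ζ)) = 2 + ζ := by
  ext
  · exact zero_add _
  · exact (add_neg_cancel 1).trans (add_zero 0).symm

namespace Girth3

open TreeEdge DiagramCode AlexanderColor

variable {k k' : TreeEdge → ℤ} {ζ : ℤ} {m : ℕ}

theorem card_coloring_quadraticUnit [NeZero m] (h : (systemMatrix k ζ).det ∣ m) :
    Nat.card (Coloring (AlexanderColor (quadraticUnit (2 + ζ : ZMod m)))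
        (K (2 * k p) (2 * k q) (2 * k r) (2 * k a) (2 * k b) (2 * k c))) =
      2 * (m ^ 2 * (systemMatrix k ζ).det.natAbs ^ 2) := by
  have e := QuadraticAlgebra.linearEquivTuple (-1 : ZMod m) (2 + ζ)
  rw [card_coloring_K_two_mul _ (quadraticUnit_add_inv ζ),
    card_ker_zmulVec_of_addEquiv_pi _ e.toAddEquiv, card_ker_zmulVec_zmod h,
    Nat.card_congr e.toEquiv, Nat.card_fun, Nat.card_zmod]
  simp

/-- The coefficient of `z²` in the Conway polynomial of `K` with `2 * k e` half twists on `e`. -/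
def conwayTwo (k : TreeEdge → ℤ) : ℤ :=
  k p * (k a + k c) + k q * (k a + k b) + k r * (k b + k c)

/-- The coefficient of `z⁴` in the Conway polynomial of `K` with `2 * k e` half twists on `e`. -/
def conwayFour (k : TreeEdge → ℤ) : ℤ :=
  (k p * k q + k q * k r + k r * k p) * (k a * k b + k b * k c + k c * k a)

theorem det_systemMatrix :
    (systemMatrix k ζ).det = 1 + conwayTwo k * ζ + conwayFour k * ζ ^ 2 := by
  rw [systemMatrix, Matrix.det_fin_two_of, conwayTwo, conwayFour]
  ring

theorem dvd_det_systemMatrix_sub_one : ζ ∣ (systemMatrix k ζ).det - 1 :=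
  ⟨conwayTwo k + conwayFour k * ζ, by rw [det_systemMatrix]; ring⟩

theorem det_systemMatrix_ne_zero (hζ : 2 < ζ) : (systemMatrix k ζ).det ≠ 0 := by
  intro h
  have hdvd : ζ ∣ 1 := by simpa [h] using dvd_det_systemMatrix_sub_one (k := k) (ζ := ζ)
  linarith [Int.le_of_dvd one_pos hdvd]

theorem natAbs_det_eq_of_sameKnot (hk : (systemMatrix k ζ).det ≠ 0)
    (hk' : (systemMatrix k' ζ).det ≠ 0)
    (h : SameKnot (K (2 * k p) (2 * k q) (2 * k r) (2 * k a) (2 * k b) (2 * k c))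
      (K (2 * k' p) (2 * k' q) (2 * k' r) (2 * k' a) (2 * k' b) (2 * k' c))) :
    (systemMatrix k ζ).det.natAbs = (systemMatrix k' ζ).det.natAbs := by
  -- Modulo a common multiple of the determinants, both kernels have the order of the determinant.
  set m := ((systemMatrix k ζ).det * (systemMatrix k' ζ).det).natAbs
  have : NeZero m := ⟨Int.natAbs_ne_zero.2 (mul_ne_zero hk hk')⟩
  have hcard := card_coloring_of_sameKnot (AlexanderColor (quadraticUnit (2 + ζ : ZMod m))) h
  rw [card_coloring_quadraticUnit (Int.dvd_natAbs.2 (dvd_mul_right _ _)),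
    card_coloring_quadraticUnit (Int.dvd_natAbs.2 (dvd_mul_left _ _))] at hcard
  have hm : 0 < m ^ 2 := pow_pos (NeZero.pos m) 2
  exact Nat.pow_left_injective two_ne_zero
    (Nat.eq_of_mul_eq_mul_left hm (Nat.eq_of_mul_eq_mul_left two_pos hcard))

theorem det_eq_of_sameKnot (hζ : 2 < ζ)
    (h : SameKnot (K (2 * k p) (2 * k q) (2 * k r) (2 * k a) (2 * k b) (2 * k c))
      (K (2 * k' p) (2 * k' q) (2 * k' r) (2 * k' a) (2 * k' b) (2 * k' c))) :
    (systemMatrix k ζ).det = (systemMatrix k' ζ).det := by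
  rcases Int.natAbs_eq_natAbs_iff.1 (natAbs_det_eq_of_sameKnot
    (det_systemMatrix_ne_zero hζ) (det_systemMatrix_ne_zero hζ) h) with heq | hneg
  · exact heq
  -- Both determinants are `1` modulo `ζ`, which rules out opposite signs.
  · have hdvd : ζ ∣ 2 := by
      have hsum := dvd_add (dvd_det_systemMatrix_sub_one (k := k) (ζ := ζ))
        (dvd_det_systemMatrix_sub_one (k := k'))
      rw [hneg] at hsum
      exact (dvd_neg.2 hsum).trans (dvd_of_eq (by ring))
    exact absurd (Int.le_of_dvd two_pos hdvd) (not_le.2 hζ)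

theorem conway_eq_of_sameKnot
    (h : SameKnot (K (2 * k p) (2 * k q) (2 * k r) (2 * k a) (2 * k b) (2 * k c))
      (K (2 * k' p) (2 * k' q) (2 * k' r) (2 * k' a) (2 * k' b) (2 * k' c))) :
    conwayTwo k = conwayTwo k' ∧ conwayFour k = conwayFour k' := by
  have h₃ := det_eq_of_sameKnot (ζ := 3) (by norm_num) h
  have h₄ := det_eq_of_sameKnot (ζ := 4) (by norm_num) h
  rw [det_systemMatrix, det_systemMatrix] at h₃ h₄
  constructor <;> linarith

/-- The labelling of the tree edges by the given numbers. -/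
def labels (np nq nr na nb nc : ℤ) : TreeEdge → ℤ
  | p => np
  | q => nq
  | r => nr
  | a => na
  | b => nb
  | c => nc

end Girth3

theorem theorem4p10 (p q r a b c : ℤ)
    (hp : Even p) (hq : Even q) (hr : Even r) (ha : Even a) (hb : Even b) (hc : Even c)
    (hpa : p ≠ a)
    (h : DiagramCode.SameKnot (Girth3.K p q r a b c) (Girth3.K a q r p b c)) :
    (q = 0 ∧ c = 0) ∨ (q = c ∧ b = r) := by
  obtain ⟨p, rfl⟩ := hp.two_dvd
  obtain ⟨q, rfl⟩ := hq.two_dvd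
  obtain ⟨r, rfl⟩ := hr.two_dvd
  obtain ⟨a, rfl⟩ := ha.two_dvd
  obtain ⟨b, rfl⟩ := hb.two_dvd
  obtain ⟨c, rfl⟩ := hc.two_dvd
  obtain ⟨h₂, h₄⟩ :=
    Girth3.conway_eq_of_sameKnot
      (k := Girth3.labels p q r a b c) (k' := Girth3.labels a q r p b c) h
  simp only [Girth3.conwayTwo, Girth3.conwayFour, Girth3.labels] at h₂ h₄
  have hpa : p - a ≠ 0 := fun hsub => hpa (by rw [sub_eq_zero.1 hsub])
  have hqc : (p - a) * (q - c) = 0 := by linear_combination -h₂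
  obtain rfl := sub_eq_zero.1 ((mul_eq_zero_iff_left hpa).1 hqc)
  have hqrb : (p - a) * (q * q * (r - b)) = 0 := by linear_combination -h₄
  rcases mul_eq_zero.1 ((mul_eq_zero_iff_left hpa).1 hqrb) with hqq | hrb
  · simp [mul_self_eq_zero.1 hqq]
  · simp [sub_eq_zero.1 hrb]
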